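/- **Model and data.** Let $d,N\ge 1$ and $k$ be integers. Vectors are row vectors. Let $\nu_\epsilon^1,\dots,\nu_\epsilon^d>0$ and $\nu_x^1,\dots,\nu_x^k>0$ be fixed degrees of freedom, let $\chi^{-1}_\nu$ be the quantile function of the chi-square distribution with $\nu$ degrees of freedom, and put $T_\epsilon(s)=(\chi^{-1}_{\nu_\epsilon^i}(s)/\nu_\epsilon^i)_{i\le d}$, $T_x(s)=(\chi^{-1}_{\nu_x^j}(s)/\nu_x^j)_{j\le k}$. For $s=(s_\epsilon,s_x)\in[0,1]^2$ let $D_\epsilon=\mathrm{diag}\,T_\epsilon(s_\epsilon)$ and $D_x=\mathrm{diag}\,T_x(s_x)$. The parameters are $\Psi=[W,\mu,\sigma^2,\delta_\epsilon,\delta_x]$ with $W\in\mathbb R^{d\times k}$, $\mu,\delta_\epsilon\in\mathbb R^d$, $\delta_x\in\mathbb R^k$, $\sigma^2>0$. The generalized skew-t PPCA model is $Y_t=\mu+X_tW^T+\epsilon_t$, $t=1,\dots,N$, independent in $t$, where, for independent uniform variables $s_\epsilon,s_x$ on $[0,1]$ and given these, $X_t\sim\mathcal N(\delta_xD_x^{-1},D_x^{-1})$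 and $\epsilon_t\sim\mathcal N(\delta_\epsilon D_\epsilon^{-1},\sigma^2D_\epsilon^{-1})$ are independent. At each time $t$ only the sub-vector $y_t^o$ of the entries in some set $o_t\subseteq\{1,\dots,d\}$ is observed; the others are missing. **The E-step function.** Fix $\Psi$ and put $M=\sigma^2D_x+W^TD_\epsilon W$, $\;\mathcal N=D_\epsilon-D_\epsilon WM^{-1}W^TD_\epsilon$, $\;b=\mu D_\epsilon W+\delta_\epsilon W-\sigma^2\delta_x$, $\;c=\delta_\epsilon W-\sigma^2\delta_x$, all but $c$ depending on $s$. Given $s$, $Y_t$ is Gaussian with mean $\mu_y=\mu+\delta_\epsilon D_\epsilon^{-1}+\sigma^2\delta_xM^{-1}W^TD_\epsilon\mathcal N^{-1}$ and covariance $\Sigma_y=\sigma^2\mathcal N^{-1}$. Let $\pi_t(s)$ be the resulting Gaussian density of $Y_t^o$ at $y_t^o$, let $E_t(s)=\mathbb E[Y_t]$ and $E^{(2)}_t(s)=\mathbb E[Y_t^TY_t]$ be the moments of $Y_t$ under the Gaussian conditional law of the missing entries given $Y_t^o=y_t^o$ and $s$, and let $$m_t=e^{-\frac12\delta_x(D_x^{-1}-\sigma^2M^{-1}W^TD_\epsilon\mathcal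 N^{-1}D_\epsilon WM^{-1}-\sigma^2M^{-1})\delta_x^T}\,\pi_t\,(\sigma^2)^{k/2}|D_\epsilon|^{1/2}|D_x|^{1/2}|M|^{-1/2}|\mathcal N|^{-1/2}.$$ For $\Psi^*=[W^*,\mu^*,\sigma^{*2},\delta_\epsilon^*,\delta_x^*]$ with $\sigma^{*2}>0$ and $G=\frac1{\sigma^{*2}}W^{*T}D_\epsilon W^*+D_x$ let $$\begin{aligned}\tilde v_t={}&\log\pi_U+\log\pi_V-\tfrac{k+d}2\log2\pi-\tfrac d2\log\sigma^{*2}+\tfrac12\log|D_\epsilon|+\tfrac12\log|D_x|-\tfrac12\delta_x^*D_x^{-1}\delta_x^{*T}-\tfrac1{2\sigma^{*2}}\mathrm{tr}\{E_t^{(2)}D_\epsilon\}\\&+\tfrac1{\sigma^{*2}}E_t(D_\epsilon\mu^{*T}+\delta_\epsilon^{*T})-\tfrac1{2\sigma^{*2}}\mu^*D_\epsilon\mu^{*T}-\tfrac1{\sigma^{*2}}\mu^*\delta_\epsilon^{*T}-\tfrac1{2\sigma^{*2}}\delta_\epsilon^*D_\epsilon^{-1}\delta_\epsilon^{*T}+\tfrac1{\sigma^{*2}}\mathrm{tr}\{E_t^{(2)}D_\epsilon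 WM^{-1}W^{*T}D_\epsilon\}\\&+(E_tD_\epsilon W-b)M^{-1}\big(-\tfrac1{\sigma^{*2}}W^{*T}D_\epsilon\mu^{*T}-\tfrac1{\sigma^{*2}}W^{*T}\delta_\epsilon^{*T}+\delta_x^{*T}\big)-\tfrac1{\sigma^{*2}}bM^{-1}W^{*T}D_\epsilon E_t^T\\&-\tfrac12\mathrm{tr}\{M^{-1}W^TD_\epsilon E_t^{(2)}D_\epsilon WM^{-1}G\}+\mathrm{tr}\{M^{-1}W^TD_\epsilon E_t^TbM^{-1}G\}-\tfrac12\mathrm{tr}\{M^{-1}b^TbM^{-1}G\}-\tfrac{\sigma^2}2\mathrm{tr}\{M^{-1}G\},\end{aligned}$$ where $\pi_U=|T_\epsilon'(s_\epsilon)|^{-1}$ and $\pi_V=|T_x'(s_x)|^{-1}$ (these do not depend on $\Psi^*$). The E-step function is $$Q(\Psi,\Psi^*)=\frac1{\pi(y^o_{1:N})}\sum_{t=1}^NH_t\int_{[0,1]^2}\tilde v_t\,m_t\,ds,\qquad H_t=\prod_{r\ne t}\int_{[0,1]^2}m_r\,ds,\qquad \pi(y^o_{1:N})=\prod_{t=1}^N\int_{[0,1]^2}\pi_t\,ds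 .$$ **The integrals.** Write $\langle F\rangle=\sum_{t=1}^NH_t\int_{[0,1]^2}F_t(s)\,m_t(s)\,ds$ and $A_0=\langle1\rangle$, $A_1=\langle D_\epsilon\rangle$, $A_2=\langle D_\epsilon^{-1}\rangle$, $A_3=\langle D_x^{-1}\rangle$, $A_4=\langle M^{-1}\rangle$, $A_5=\langle E\rangle$, $A_6=\langle ED_\epsilon\rangle$, $A_7=\langle ED_\epsilon W^*M^{-1}\rangle$, $A_8=\langle ED_\epsilon WM^{-1}\rangle$, $A_9=\langle ED_\epsilon W^*M^{-1}W^TD_\epsilon\rangle$, $A_{10}=\langle ED_\epsilon WM^{-1}W^{*T}D_\epsilon\rangle$, $A_{11}=\langle D_\epsilon WM^{-1}\rangle$, $A_{12}=\langle D_\epsilon W^*M^{-1}\rangle$, $A_{13}=\langle D_\epsilon WM^{-1}W^{*T}D_\epsilon\rangle$, $A_{14}=\langle D_\epsilon E^{(2)}D_\epsilon WM^{-1}\rangle$, $A_{15}=\langle D_\epsilon\mu^{*T}ED_\epsilon WM^{-1}\rangle$, $A_{16}=\langle D_\epsilon(E-\mu^*)^TbM^{-1}\rangle$, $A_{17}=\langle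 D_\epsilon W^*M^{-1}W^TD_\epsilon E^{(2)}D_\epsilon WM^{-1}\rangle$, $A_{18.1}=\langle D_\epsilon W^*M^{-1}W^TD_\epsilon E^TbM^{-1}\rangle$, $A_{18.2}=\langle D_\epsilon W^*M^{-1}b^TED_\epsilon WM^{-1}\rangle$, $A_{19}=\langle D_\epsilon W^*M^{-1}b^TbM^{-1}\rangle$, $A_{20}=\langle\mathrm{tr}\{E^{(2)}D_\epsilon\}\rangle$, $A_{21}=\langle\mathrm{tr}\{E^{(2)}D_\epsilon WM^{-1}W^{*T}D_\epsilon\}\rangle$. Assume that all these integrals, the one in $Q$ and those in $\pi(y^o_{1:N})$ converge absolutely for all $\Psi^*$ with $\sigma^{*2}>0$. **Theorem.** For every $\Psi^*$ with $\sigma^{*2}>0$, $Q(\Psi,\cdot)$ is differentiable at $\Psi^*$, and $\nabla_{\Psi^*}Q(\Psi,\Psi^*)=0$ if and only if $$\begin{aligned} \mu^*={}&\big[A_6-A_{10}-A_0\delta_\epsilon^*+\mu A_{13}+cA_{12}^T\big]A_1^{-1},\\ \delta_\epsilon^*={}&\big[A_5-A_0\mu^*-A_8W^{*T}+\mu A_{11}W^{*T}+cA_4W^{*T}\big]A_2^{-1},\\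 \delta_x^*={}&\big[A_8-\mu A_{11}-cA_4\big]A_3^{-1},\\ \sigma^{*2}={}&\tfrac1{dA_0}\big[A_{20}+\mu^*A_1\mu^{*T}+\delta_\epsilon^*A_2\delta_\epsilon^{*T}+2A_9\mu^T+2(A_{10}-A_6-\mu A_{13})\mu^{*T}-2A_{21}+\sigma^2\mathrm{tr}\{A_{12}^TW^*\}\\&+\mathrm{tr}\{A_{17}^TW^*\}-\mathrm{tr}\{A_{18.1}^TW^*\}-\mathrm{tr}\{A_{18.2}^TW^*\}+\mathrm{tr}\{A_{19}^TW^*\}+2(A_0\mu^*-A_5+A_8W^{*T}-\mu A_{11}W^{*T})\delta_\epsilon^{*T}\\&+2(A_7-\mu^*A_{12}-\delta_\epsilon^*W^*A_4)c^T\big],\\ f(W^*)={}&0, \end{aligned}$$ where $$\begin{aligned}f(W^*)={}&A_{14}-A_{15}-\delta_\epsilon^{*T}A_8-A_{16}+\delta_\epsilon^{*T}\mu A_{11}+\delta_\epsilon^{*T}cA_4-A_{17}+A_{18.1}+A_{18.2}-A_{19}-\sigma^2A_{12}\\={}&\sigma^{*2}\,\pi(y^o_{1:N})\,\frac{\partial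 Q(\Psi,\Psi^*)}{\partial W^*},\qquad \pi(y^o_{1:N})>0 .\end{aligned}$$ More precisely, each of the first four equations is equivalent to the vanishing of the partial derivative of $Q$ in $\mu^*$, $\delta_\epsilon^*$, $\delta_x^*$, $\sigma^{*2}$, respectively. The system characterises the maximizers: $\Psi^*$ satisfies it if and only if it maximizes $Q(\Psi,\cdot)$ over all parameters with $\sigma^{*2}>0$. Moreover (linear meaning affine): the updates for $\mu^*$ and for $\delta_\epsilon^*$ are linear in $W^*$, and so is the unique joint solution $(\mu^*,\delta_\epsilon^*)$ of their two equations; the formula for $\sigma^{*2}$ is linear in $W^*$ when the integrals $A_i$ are held fixed as coefficients, and linear in the $W^*$ inside the integrals when the other occurrences of $W^*$ are held fixed ($\mu^*$ and $\delta_\epsilon^*$ being given in both cases); and $f$ is linear in $(\mu^*,\delta_\epsilon^*)$. -/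

import Mathlib

open MeasureTheory ProbabilityTheory
open scoped Matrix

noncomputable section

namespace GStPPCA

/-! ### Parameters and data -/

/-- The parameters `Ψ = [W, μ, σ², δ_ε, δ_x]` that the EM algorithm updates, as a point of the
normed space `ℝ^{d×k} × ℝ^d × ℝ × ℝ^d × ℝ^k`. -/
abbrev Param (d k : ℕ) : Type :=
  (Fin d → Fin k → ℝ) × (Fin d → ℝ) × ℝ × (Fin d → ℝ) × (Fin k → ℝ)

/-- A vector as a matrix with one row. -/
def row {ι : Type*} (v : ι → ℝ) : Matrix (Fin 1) ι ℝ := Matrix.of fun _ i => v i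

namespace Param

variable {d k : ℕ}

def W (S : Param d k) : Matrix (Fin d) (Fin k) ℝ := Matrix.of S.1
def mu (S : Param d k) : Matrix (Fin 1) (Fin d) ℝ := row S.2.1
def sigma2 (S : Param d k) : ℝ := S.2.2.1
def deltaEps (S : Param d k) : Matrix (Fin 1) (Fin d) ℝ := row S.2.2.2.1
def deltaX (S : Param d k) : Matrix (Fin 1) (Fin k) ℝ := row S.2.2.2.2

end Param

/-- What is fixed throughout an EM step: the degrees of freedom, the set `obs t` of the
coordinates observed at time `t`, and the observed values `y t`. -/
structure Data (d k N : ℕ) where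
  nuEps : Fin d → ℝ
  nuX : Fin k → ℝ
  obs : Fin N → Finset (Fin d)
  y : (t : Fin N) → {i : Fin d // i ∈ obs t} → ℝ

/-! ### The latent scale variables -/

/-- The quantile function of the chi-square distribution with `ν` degrees of freedom, that is,
of the Gamma distribution with shape `ν / 2` and rate `1 / 2`. -/
def chiSqQuantile (ν s : ℝ) : ℝ :=
  sInf {x : ℝ | 0 ≤ x ∧ s ≤ cdf (gammaMeasure (ν / 2) (1 / 2)) x}

/-- The map `T(s) = (χ⁻¹_{ν¹}(s) / ν¹, …, χ⁻¹_{νⁿ}(s) / νⁿ)`. -/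
def scaleVec {n : ℕ} (ν : Fin n → ℝ) (s : ℝ) : Fin n → ℝ :=
  fun i => chiSqQuantile (ν i) s / ν i

/-- The logarithm of the density of the random vector `T(S)`, `S` uniform on `[0, 1]`, at the
point `T(s)`: the density is `|∂T(s) / ∂s|⁻¹` with respect to arc length on the curve `T`. -/
def logScaleDensity {n : ℕ} (ν : Fin n → ℝ) (s : ℝ) : ℝ :=
  - Real.log ‖deriv (fun r : ℝ => (WithLp.toLp 2 (scaleVec ν r) : EuclideanSpace ℝ (Fin n))) s‖

/-- The square `[0, 1]²`; its points are written `s = (s_ε, s_x)`. -/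
def unitSquare : Set (ℝ × ℝ) := Set.Icc 0 1 ×ˢ Set.Icc 0 1

section Model

variable {d k N : ℕ} (D : Data d k N) (P : Param d k)

def Deps (s : ℝ × ℝ) : Matrix (Fin d) (Fin d) ℝ := Matrix.diagonal (scaleVec D.nuEps s.1)

def Dx (s : ℝ × ℝ) : Matrix (Fin k) (Fin k) ℝ := Matrix.diagonal (scaleVec D.nuX s.2)

/-- `M = σ² D_x + Wᵀ D_ε W` -/
def M (s : ℝ × ℝ) : Matrix (Fin k) (Fin k) ℝ :=
  P.sigma2 • Dx D s + P.Wᵀ * Deps D s * P.W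

/-- `N = D_ε - D_ε W M⁻¹ Wᵀ D_ε` -/
def Nmat (s : ℝ × ℝ) : Matrix (Fin d) (Fin d) ℝ :=
  Deps D s - Deps D s * P.W * (M D P s)⁻¹ * P.Wᵀ * Deps D s

/-- `δ_ε W - σ² δ_x` -/
def cvec : Matrix (Fin 1) (Fin k) ℝ := P.deltaEps * P.W - P.sigma2 • P.deltaX

/-- `μ D_ε W + δ_ε W - σ² δ_x` -/
def bvec (s : ℝ × ℝ) : Matrix (Fin 1) (Fin k) ℝ :=
  P.mu * Deps D s * P.W + P.deltaEps * P.W - P.sigma2 • P.deltaX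

/-! ### Conditional Gaussian distributions given the scale variables -/

/-- The mean of `Y_t` given the scale variables. -/
def muY (s : ℝ × ℝ) : Matrix (Fin 1) (Fin d) ℝ :=
  P.mu + P.deltaEps * (Deps D s)⁻¹ +
    P.sigma2 • (P.deltaX * (M D P s)⁻¹ * P.Wᵀ * Deps D s * (Nmat D P s)⁻¹)

/-- The covariance matrix of `Y_t` given the scale variables. -/
def SigmaY (s : ℝ × ℝ) : Matrix (Fin d) (Fin d) ℝ := P.sigma2 • (Nmat D P s)⁻¹

/-- The indices of the observed and of the missing entries at time `t`. -/
abbrev Obs (t : Fin N) : Type := {i : Fin d // i ∈ D.obs t}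
abbrev Mis (t : Fin N) : Type := {i : Fin d // i ∉ D.obs t}

def SigmaOO (t : Fin N) (s : ℝ × ℝ) : Matrix (Obs D t) (Obs D t) ℝ :=
  (SigmaY D P s).submatrix Subtype.val Subtype.val

def SigmaOM (t : Fin N) (s : ℝ × ℝ) : Matrix (Obs D t) (Mis D t) ℝ :=
  (SigmaY D P s).submatrix Subtype.val Subtype.val

def SigmaMO (t : Fin N) (s : ℝ × ℝ) : Matrix (Mis D t) (Obs D t) ℝ :=
  (SigmaY D P s).submatrix Subtype.val Subtype.val

def SigmaMM (t : Fin N) (s : ℝ × ℝ) : Matrix (Mis D t) (Mis D t) ℝ :=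
  (SigmaY D P s).submatrix Subtype.val Subtype.val

/-- `y_t^o - μ_{y,t}^o` -/
def residO (t : Fin N) (s : ℝ × ℝ) : Matrix (Fin 1) (Obs D t) ℝ :=
  row (D.y t) - (muY D P s).submatrix id Subtype.val

/-- The Gaussian density of `Y_t^o` given the scale variables, at the observed value. -/
def densO (t : Fin N) (s : ℝ × ℝ) : ℝ :=
  (2 * Real.pi) ^ (-((D.obs t).card : ℝ) / 2) * (SigmaOO D P t s).det ^ (-(1 / 2) : ℝ) *
    Real.exp (-(1 / 2) * (residO D P t s * (SigmaOO D P t s)⁻¹ * (residO D P t s)ᵀ).trace)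

/-- The mean of `Y_t^m` given `Y_t^o` and the scale variables. -/
def muTilde (t : Fin N) (s : ℝ × ℝ) : Matrix (Fin 1) (Mis D t) ℝ :=
  (muY D P s).submatrix id Subtype.val + residO D P t s * (SigmaOO D P t s)⁻¹ * SigmaOM D P t s

/-- The covariance matrix of `Y_t^m` given `Y_t^o` and the scale variables. -/
def SigmaTilde (t : Fin N) (s : ℝ × ℝ) : Matrix (Mis D t) (Mis D t) ℝ :=
  SigmaMM D P t s - SigmaMO D P t s * (SigmaOO D P t s)⁻¹ * SigmaOM D P t s

/-- `E[Y_t]` under the law of `Y_t^m` given `Y_t^o` and the scale variables. -/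
def EY (t : Fin N) (s : ℝ × ℝ) : Matrix (Fin 1) (Fin d) ℝ :=
  Matrix.of fun r i => if h : i ∈ D.obs t then D.y t ⟨i, h⟩ else muTilde D P t s r ⟨i, h⟩

/-- `E[Y_tᵀ Y_t]` under the law of `Y_t^m` given `Y_t^o` and the scale variables. -/
def EYY (t : Fin N) (s : ℝ × ℝ) : Matrix (Fin d) (Fin d) ℝ :=
  (Matrix.of fun i j =>
    if hi : i ∈ D.obs t then 0 else
      if hj : j ∈ D.obs t then 0 else SigmaTilde D P t s ⟨i, hi⟩ ⟨j, hj⟩) +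
    (EY D P t s)ᵀ * EY D P t s

/-! ### The E-step function `Q` -/

/-- The weight `m(y_t^o, s_ε, s_x; Ψ)`. -/
def m (t : Fin N) (s : ℝ × ℝ) : ℝ :=
  Real.exp (-(1 / 2) * (P.deltaX * ((Dx D s)⁻¹
      - P.sigma2 • ((M D P s)⁻¹ * P.Wᵀ * Deps D s * (Nmat D P s)⁻¹ * Deps D s * P.W * (M D P s)⁻¹)
      - P.sigma2 • (M D P s)⁻¹) * P.deltaXᵀ).trace) *
    densO D P t s * P.sigma2 ^ ((k : ℝ) / 2) * (Deps D s).det ^ (1 / 2 : ℝ) *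
    (Dx D s).det ^ (1 / 2 : ℝ) * (M D P s).det ^ (-(1 / 2) : ℝ) *
    (Nmat D P s).det ^ (-(1 / 2) : ℝ)

/-- The function `ṽ(y_t^o, s_ε, s_x; Ψ, Ψ*)`: the conditional expectation, given `y_t^o` and the
scale variables, of the complete-data log-density under `Ψ* = S`. -/
def v (S : Param d k) (t : Fin N) (s : ℝ × ℝ) : ℝ :=
  logScaleDensity D.nuEps s.1 + logScaleDensity D.nuX s.2
  - ((k : ℝ) + d) / 2 * Real.log (2 * Real.pi) - (d : ℝ) / 2 * Real.log S.sigma2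
  + 1 / 2 * ∑ i, Real.log (scaleVec D.nuEps s.1 i)
  + 1 / 2 * ∑ j, Real.log (scaleVec D.nuX s.2 j)
  - 1 / 2 * (S.deltaX * (Dx D s)⁻¹ * S.deltaXᵀ).trace
  - 1 / (2 * S.sigma2) * (EYY D P t s * Deps D s).trace
  + 1 / S.sigma2 * (EY D P t s * (Deps D s * S.muᵀ + S.deltaEpsᵀ)).trace
  - 1 / (2 * S.sigma2) * (S.mu * Deps D s * S.muᵀ).trace
  - 1 / S.sigma2 * (S.mu * S.deltaEpsᵀ).trace
  - 1 / (2 * S.sigma2) * (S.deltaEps * (Deps D s)⁻¹ * S.deltaEpsᵀ).trace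
  + 1 / S.sigma2 * (EYY D P t s * Deps D s * P.W * (M D P s)⁻¹ * S.Wᵀ * Deps D s).trace
  + (EY D P t s * Deps D s * P.W * (M D P s)⁻¹ *
      (-(1 / S.sigma2) • (S.Wᵀ * Deps D s * S.muᵀ) - (1 / S.sigma2) • (S.Wᵀ * S.deltaEpsᵀ)
        + S.deltaXᵀ)).trace
  + 1 / S.sigma2 * (-bvec D P s * (M D P s)⁻¹ * S.Wᵀ * Deps D s * (EY D P t s)ᵀ).trace
  + (-bvec D P s * (M D P s)⁻¹ *
      (-(1 / S.sigma2) • (S.Wᵀ * Deps D s * S.muᵀ) - (1 / S.sigma2) • (S.Wᵀ * S.deltaEpsᵀ)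
        + S.deltaXᵀ)).trace
  - 1 / 2 * ((M D P s)⁻¹ * P.Wᵀ * Deps D s * EYY D P t s * Deps D s * P.W * (M D P s)⁻¹ *
      ((1 / S.sigma2) • (S.Wᵀ * Deps D s * S.W) + Dx D s)).trace
  - ((M D P s)⁻¹ * P.Wᵀ * Deps D s * (EY D P t s)ᵀ * (-bvec D P s) * (M D P s)⁻¹ *
      ((1 / S.sigma2) • (S.Wᵀ * Deps D s * S.W) + Dx D s)).trace
  - 1 / 2 * ((M D P s)⁻¹ * (-bvec D P s)ᵀ * (-bvec D P s) * (M D P s)⁻¹ *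
      ((1 / S.sigma2) • (S.Wᵀ * Deps D s * S.W) + Dx D s)).trace
  - P.sigma2 / 2 * ((M D P s)⁻¹ *
      ((1 / S.sigma2) • (S.Wᵀ * Deps D s * S.W) + Dx D s)).trace

def I1 (S : Param d k) (t : Fin N) : ℝ := ∫ s in unitSquare, v D P S t s * m D P t s

def I2 (t : Fin N) : ℝ := ∫ s in unitSquare, m D P t s

/-- The density of the observed data `y_{1:N}^o` under `Ψ`. -/
def likelihood : ℝ := ∏ t, ∫ s in unitSquare, densO D P t s

/-- The E-step function `Ψ* ↦ Q(Ψ, Ψ*)`. -/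
def Q (S : Param d k) : ℝ :=
  1 / likelihood D P * ∑ t, I1 D P S t * ∏ r ∈ Finset.univ.erase t, I2 D P r

/-! ### The two-dimensional integrals

`a_i` is the integrand, without the weight `m`, of the integral `A_i`. The arguments `w` and `mu'`
stand for `W*` and `μ*`. -/

/-- `H(y_{1:N/t}^o; Ψ)` -/
def H (t : Fin N) : ℝ := ∏ r ∈ Finset.univ.erase t, I2 D P r

/-- `∑_t H_t ∫∫ F_t m_t ds_ε ds_x`, entry by entry. -/
def intA {ι κ : Type} (F : Fin N → ℝ × ℝ → Matrix ι κ ℝ) : Matrix ι κ ℝ :=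
  Matrix.of fun i j => ∑ t, H D P t * ∫ s in unitSquare, F t s i j * m D P t s

/-- The integrals in `intA` converge. -/
def Converges {ι κ : Type} (F : Fin N → ℝ × ℝ → Matrix ι κ ℝ) : Prop :=
  ∀ t i j, IntegrableOn (fun s => F t s i j * m D P t s) unitSquare

variable (w : Matrix (Fin d) (Fin k) ℝ) (mu' : Matrix (Fin 1) (Fin d) ℝ)

/-- A number as a matrix with one entry. -/
def scalar (x : ℝ) : Matrix (Fin 1) (Fin 1) ℝ := Matrix.of fun _ _ => x

def a0 (_ : Fin N) (_ : ℝ × ℝ) : Matrix (Fin 1) (Fin 1) ℝ := scalar 1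
def a1 (_ : Fin N) (s : ℝ × ℝ) : Matrix (Fin d) (Fin d) ℝ := Deps D s
def a2 (_ : Fin N) (s : ℝ × ℝ) : Matrix (Fin d) (Fin d) ℝ := (Deps D s)⁻¹
def a3 (_ : Fin N) (s : ℝ × ℝ) : Matrix (Fin k) (Fin k) ℝ := (Dx D s)⁻¹
def a4 (_ : Fin N) (s : ℝ × ℝ) : Matrix (Fin k) (Fin k) ℝ := (M D P s)⁻¹
def a5 (t : Fin N) (s : ℝ × ℝ) : Matrix (Fin 1) (Fin d) ℝ := EY D P t s
def a6 (t : Fin N) (s : ℝ × ℝ) : Matrix (Fin 1) (Fin d) ℝ := EY D P t s * Deps D s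
def a7 (t : Fin N) (s : ℝ × ℝ) : Matrix (Fin 1) (Fin k) ℝ :=
  EY D P t s * Deps D s * w * (M D P s)⁻¹
def a8 (t : Fin N) (s : ℝ × ℝ) : Matrix (Fin 1) (Fin k) ℝ :=
  EY D P t s * Deps D s * P.W * (M D P s)⁻¹
def a9 (t : Fin N) (s : ℝ × ℝ) : Matrix (Fin 1) (Fin d) ℝ :=
  EY D P t s * Deps D s * w * (M D P s)⁻¹ * P.Wᵀ * Deps D s
def a10 (t : Fin N) (s : ℝ × ℝ) : Matrix (Fin 1) (Fin d) ℝ :=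
  EY D P t s * Deps D s * P.W * (M D P s)⁻¹ * wᵀ * Deps D s
def a11 (_ : Fin N) (s : ℝ × ℝ) : Matrix (Fin d) (Fin k) ℝ :=
  Deps D s * P.W * (M D P s)⁻¹
def a12 (_ : Fin N) (s : ℝ × ℝ) : Matrix (Fin d) (Fin k) ℝ :=
  Deps D s * w * (M D P s)⁻¹
def a13 (_ : Fin N) (s : ℝ × ℝ) : Matrix (Fin d) (Fin d) ℝ :=
  Deps D s * P.W * (M D P s)⁻¹ * wᵀ * Deps D s
def a14 (t : Fin N) (s : ℝ × ℝ) : Matrix (Fin d) (Fin k) ℝ :=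
  Deps D s * EYY D P t s * Deps D s * P.W * (M D P s)⁻¹
def a15 (t : Fin N) (s : ℝ × ℝ) : Matrix (Fin d) (Fin k) ℝ :=
  Deps D s * mu'ᵀ * EY D P t s * Deps D s * P.W * (M D P s)⁻¹
def a16 (t : Fin N) (s : ℝ × ℝ) : Matrix (Fin d) (Fin k) ℝ :=
  Deps D s * (EY D P t s - mu')ᵀ * bvec D P s * (M D P s)⁻¹
def a17 (t : Fin N) (s : ℝ × ℝ) : Matrix (Fin d) (Fin k) ℝ :=
  Deps D s * w * (M D P s)⁻¹ * P.Wᵀ * Deps D s * EYY D P t s * Deps D s * P.W * (M D P s)⁻¹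
def a18_1 (t : Fin N) (s : ℝ × ℝ) : Matrix (Fin d) (Fin k) ℝ :=
  Deps D s * w * (M D P s)⁻¹ * P.Wᵀ * Deps D s * (EY D P t s)ᵀ * bvec D P s * (M D P s)⁻¹
def a18_2 (t : Fin N) (s : ℝ × ℝ) : Matrix (Fin d) (Fin k) ℝ :=
  Deps D s * w * (M D P s)⁻¹ * (bvec D P s)ᵀ * EY D P t s * Deps D s * P.W * (M D P s)⁻¹
def a19 (_ : Fin N) (s : ℝ × ℝ) : Matrix (Fin d) (Fin k) ℝ :=
  Deps D s * w * (M D P s)⁻¹ * (bvec D P s)ᵀ * bvec D P s * (M D P s)⁻¹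
def a20 (t : Fin N) (s : ℝ × ℝ) : Matrix (Fin 1) (Fin 1) ℝ :=
  scalar (EYY D P t s * Deps D s).trace
def a21 (t : Fin N) (s : ℝ × ℝ) : Matrix (Fin 1) (Fin 1) ℝ :=
  scalar (EYY D P t s * Deps D s * P.W * (M D P s)⁻¹ * wᵀ * Deps D s).trace

def A0 : ℝ := (intA D P a0).trace
def A1 : Matrix (Fin d) (Fin d) ℝ := intA D P (a1 D)
def A2 : Matrix (Fin d) (Fin d) ℝ := intA D P (a2 D)
def A3 : Matrix (Fin k) (Fin k) ℝ := intA D P (a3 D)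
def A4 : Matrix (Fin k) (Fin k) ℝ := intA D P (a4 D P)
def A5 : Matrix (Fin 1) (Fin d) ℝ := intA D P (a5 D P)
def A6 : Matrix (Fin 1) (Fin d) ℝ := intA D P (a6 D P)
def A7 : Matrix (Fin 1) (Fin k) ℝ := intA D P (a7 D P w)
def A8 : Matrix (Fin 1) (Fin k) ℝ := intA D P (a8 D P)
def A9 : Matrix (Fin 1) (Fin d) ℝ := intA D P (a9 D P w)
def A10 : Matrix (Fin 1) (Fin d) ℝ := intA D P (a10 D P w)
def A11 : Matrix (Fin d) (Fin k) ℝ := intA D P (a11 D P)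
def A12 : Matrix (Fin d) (Fin k) ℝ := intA D P (a12 D P w)
def A13 : Matrix (Fin d) (Fin d) ℝ := intA D P (a13 D P w)
def A14 : Matrix (Fin d) (Fin k) ℝ := intA D P (a14 D P)
def A15 : Matrix (Fin d) (Fin k) ℝ := intA D P (a15 D P mu')
def A16 : Matrix (Fin d) (Fin k) ℝ := intA D P (a16 D P mu')
def A17 : Matrix (Fin d) (Fin k) ℝ := intA D P (a17 D P w)
def A18_1 : Matrix (Fin d) (Fin k) ℝ := intA D P (a18_1 D P w)
def A18_2 : Matrix (Fin d) (Fin k) ℝ := intA D P (a18_2 D P w)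
def A19 : Matrix (Fin d) (Fin k) ℝ := intA D P (a19 D P w)
def A20 : ℝ := (intA D P (a20 D P)).trace
def A21 : ℝ := (intA D P (a21 D P w)).trace

/-- All the integrals over `[0, 1]²` that occur are absolutely convergent, so that the density of
the data, the function `Q` and `A_0, …, A_21` are well defined. -/
structure IntegralsConverge : Prop where
  density : ∀ t, IntegrableOn (densO D P t) unitSquare
  estep : ∀ (S : Param d k) (t : Fin N), 0 < S.sigma2 →
    IntegrableOn (fun s => v D P S t s * m D P t s) unitSquare
  c0 : Converges D P a0
  c1 : Converges D P (a1 D)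
  c2 : Converges D P (a2 D)
  c3 : Converges D P (a3 D)
  c4 : Converges D P (a4 D P)
  c5 : Converges D P (a5 D P)
  c6 : Converges D P (a6 D P)
  c7 : ∀ w, Converges D P (a7 D P w)
  c8 : Converges D P (a8 D P)
  c9 : ∀ w, Converges D P (a9 D P w)
  c10 : ∀ w, Converges D P (a10 D P w)
  c11 : Converges D P (a11 D P)
  c12 : ∀ w, Converges D P (a12 D P w)
  c13 : ∀ w, Converges D P (a13 D P w)
  c14 : Converges D P (a14 D P)
  c15 : ∀ mu', Converges D P (a15 D P mu')
  c16 : ∀ mu', Converges D P (a16 D P mu')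
  c17 : ∀ w, Converges D P (a17 D P w)
  c18_1 : ∀ w, Converges D P (a18_1 D P w)
  c18_2 : ∀ w, Converges D P (a18_2 D P w)
  c19 : ∀ w, Converges D P (a19 D P w)
  c20 : Converges D P (a20 D P)
  c21 : ∀ w, Converges D P (a21 D P w)

/-! ### The update formulas

`S` stands for `Ψ*`. -/

variable (S : Param d k)

/-- The right-hand side of the equation for `μ*`. -/
def muUpdate : Matrix (Fin 1) (Fin d) ℝ :=
  (A6 D P - A10 D P S.W - A0 D P • S.deltaEps + P.mu * A13 D P S.W + cvec P * (A12 D P S.W)ᵀ) *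
    (A1 D P)⁻¹

/-- The right-hand side of the equation for `δ_ε*`. -/
def deltaEpsUpdate : Matrix (Fin 1) (Fin d) ℝ :=
  (A5 D P - A0 D P • S.mu - A8 D P * S.Wᵀ + P.mu * A11 D P * S.Wᵀ + cvec P * A4 D P * S.Wᵀ) *
    (A2 D P)⁻¹

/-- The right-hand side of the equation for `δ_x*`. -/
def deltaXUpdate : Matrix (Fin 1) (Fin k) ℝ :=
  (A8 D P - P.mu * A11 D P - cvec P * A4 D P) * (A3 D P)⁻¹

/-- The formula for `σ*²`, with the matrix `w` in place of `W*` inside the integrals `A_i` and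
with `μ*`, `δ_ε*`, and `W*` outside the integrals taken from `S`. -/
def sigma2Formula : ℝ :=
  1 / (d * A0 D P) *
    (A20 D P + (S.mu * A1 D P * S.muᵀ).trace + (S.deltaEps * A2 D P * S.deltaEpsᵀ).trace
      + 2 * (A9 D P w * P.muᵀ).trace
      + 2 * ((A10 D P w - A6 D P - P.mu * A13 D P w) * S.muᵀ).trace
      - 2 * A21 D P w
      + P.sigma2 * ((A12 D P w)ᵀ * S.W).trace
      + ((A17 D P w)ᵀ * S.W).trace
      - ((A18_1 D P w)ᵀ * S.W).trace
      - ((A18_2 D P w)ᵀ * S.W).trace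
      + ((A19 D P w)ᵀ * S.W).trace
      + 2 * ((A0 D P • S.mu - A5 D P + A8 D P * S.Wᵀ - P.mu * A11 D P * S.Wᵀ) *
          S.deltaEpsᵀ).trace
      + 2 * ((A7 D P w - S.mu * A12 D P w - S.deltaEps * S.W * A4 D P) * (cvec P)ᵀ).trace)

/-- The right-hand side of the equation for `σ*²`. -/
def sigma2Update : ℝ := sigma2Formula D P S.W S

/-- The matrix function `f(W*; Ψ, Ψ*)`. -/
def f : Matrix (Fin d) (Fin k) ℝ :=
  A14 D P - A15 D P S.mu - S.deltaEpsᵀ * A8 D P - A16 D P S.mu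
    + S.deltaEpsᵀ * P.mu * A11 D P + S.deltaEpsᵀ * cvec P * A4 D P
    - A17 D P S.W + A18_1 D P S.W + A18_2 D P S.W - A19 D P S.W - P.sigma2 • A12 D P S.W

/-- `Ψ* = S` solves the system of the M-step. -/
def SolvesMStep : Prop :=
  S.mu = muUpdate D P S ∧ S.deltaEps = deltaEpsUpdate D P S ∧ S.deltaX = deltaXUpdate D P ∧
    S.sigma2 = sigma2Update D P S ∧ f D P S = 0

end Model

end GStPPCA

end

open GStPPCA

/-! ### The chi-square quantile function on (0, 1) -/

namespace GStPPCA

/-! For `s` in the open square the quantiles are strictly positive, so `D_ε`, `D_x`, `M` and `Nmat`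
are positive definite and the conditional Gaussian formulas are meaningful; the boundary of the
square is null. For such `s`, `v` has the form const - (d/2) log σ*² - ½ δ_x* D_x⁻¹ δ_x*ᵀ + E[X_t]
δ_x*ᵀ - q / (2σ*²), where `q` is the conditional expectation of the squared norm, in the metric
`D_ε`, of the residual Y_t - μ* - X_t W*ᵀ - δ_ε* D_ε⁻¹. The residual is affine in (W*, μ*, δ_ε*), so
`q` is a quadratic polynomial with positive semidefinite second-order part (`fitForm_eq_integrand`),
and its first variation gives the integrands of the score equations (`fitLin_sub_fitForm`).

Weighted integration preserves this shape. In order to integrate term by term without proving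
convergence of each term, the integral is extended to a linear functional Λ on all functions
(`exists_linear_extension`, `Extends.map_v`). Such an extension need not be positive;
semidefiniteness of the integrated form is recovered from a second difference of `v`, which
converges by assumption (`Extends.intForm_self_nonneg`).

Thus `Q` is, up to a positive factor, a linear-quadratic function of δ_x* minus α log σ*² minus
(quadratic)/(2σ*²). Its derivative is explicit (`hasFDerivAt_logGaussian`), and `A_1`, `A_2`, `A_3`
are diagonal with positive entries, so the score equations can be solved for μ*, δ_ε*, δ_x*. `Q` is
not concave in σ*²; a critical point is nevertheless a global maximum, because it minimises the
quadratic part whatever σ*² is, and the remaining comparison is log x ≤ x - 1 (`logGaussian_le`).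

The affine statements come from linearity of the integrands in W* or their affine dependence on μ*.
The joint solution for (μ*, δ_ε*) decouples into `d` systems of size 2 × 2, invertible by strict
Cauchy-Schwarz (`Extends.A0_sq_lt`). -/

theorem continuous_cdf_gammaMeasure {a r : ℝ} (ha : 0 < a) (hr : 0 < r) :
    Continuous (cdf (gammaMeasure a r)) := by
  have hp : IsProbabilityMeasure (gammaMeasure a r) := isProbabilityMeasure_gammaMeasure ha hr
  have hna : NullSingletonClass (gammaMeasure a r) :=
    ⟨fun x => withDensity_absolutelyContinuous _ _ (measure_singleton x)⟩
  rw [continuous_iff_continuousAt]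
  intro x
  -- The jump of the cdf at `x` is the mass of `{x}`, which is zero since the law has a density. So
  -- the left limit is the value, and right continuity is built into a cdf.
  have h0 : (cdf (gammaMeasure a r)).measure {x} = 0 := by
    rw [measure_cdf]; exact measure_singleton x
  rw [StieltjesFunction.measure_singleton, ENNReal.ofReal_eq_zero] at h0
  have hle := (monotone_cdf (gammaMeasure a r)).leftLim_le (le_refl x)
  rw [continuousAt_iff_continuous_left'_right']
  constructor
  · have := (monotone_cdf (gammaMeasure a r)).tendsto_leftLim x
    rw [le_antisymm hle (by linarith)] at this
    exact this
  · exact ((cdf (gammaMeasure a r)).right_continuous x).mono Set.Ioi_subset_Ici_self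

theorem cdf_gammaMeasure_zero {a r : ℝ} (ha : 0 < a) (hr : 0 < r) :
    cdf (gammaMeasure a r) 0 = 0 := by
  rw [cdf_gammaMeasure_eq_lintegral ha hr, setLIntegral_congr Iio_ae_eq_Iic.symm,
    lintegral_gammaPDF_of_nonpos le_rfl, ENNReal.toReal_zero]

/-- Continuity of the cdf makes the defining set closed, so its infimum is attained, which gives `≥
s`. Positive points to the left of the infimum lie outside the set, so the left limit gives `≤ s`.
Positivity holds because the cdf vanishes at 0. The endpoints are excluded: at `s = 0` the infimum
is 0, and at `s = 1` the set is empty and `sInf` is again 0. -/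
theorem cdf_chiSqQuantile {ν s : ℝ} (hν : 0 < ν) (hs : s ∈ Set.Ioo (0 : ℝ) 1) :
    0 < chiSqQuantile ν s ∧ cdf (gammaMeasure (ν / 2) (1 / 2)) (chiSqQuantile ν s) = s := by
  have ha : 0 < ν / 2 := by positivity
  have hr : (0 : ℝ) < 1 / 2 := by norm_num
  set F := cdf (gammaMeasure (ν / 2) (1 / 2)) with hF
  have hc : Continuous F := continuous_cdf_gammaMeasure ha hr
  have hF0 : F 0 = 0 := cdf_gammaMeasure_zero ha hr
  set A : Set ℝ := {x : ℝ | 0 ≤ x ∧ s ≤ F x} with hA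
  have hcl : IsClosed A := (isClosed_le continuous_const continuous_id).inter
    (isClosed_le continuous_const hc)
  have hbd : BddBelow A := ⟨0, fun x hx => hx.1⟩
  have hne : A.Nonempty := by
    have h1 := (tendsto_cdf_atTop (gammaMeasure (ν / 2) (1 / 2))).eventually (lt_mem_nhds hs.2)
    obtain ⟨x, hx1, hx2⟩ := (h1.and (Filter.eventually_ge_atTop 0)).exists
    exact ⟨x, hx2, hx1.le⟩
  have hmem : sInf A ∈ A := hcl.csInf_mem hne hbd
  have hpos : 0 < sInf A := by
    refine lt_of_le_of_ne hmem.1 fun h => ?_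
    have := hmem.2
    rw [← h, hF0] at this
    exact absurd hs.1 (not_lt.2 this)
  refine ⟨hpos, le_antisymm ?_ hmem.2⟩
  change F (sInf A) ≤ s
  have hlim : Filter.Tendsto F (nhdsWithin (sInf A) (Set.Iio (sInf A))) (nhds (F (sInf A))) :=
    (hc.tendsto _).mono_left nhdsWithin_le_nhds
  refine le_of_tendsto hlim ?_
  filter_upwards [Ioo_mem_nhdsLT hpos] with x hx
  by_contra hcon
  exact absurd (csInf_le hbd (show x ∈ A from ⟨hx.1.le, (not_le.1 hcon).le⟩)) (not_le.2 hx.2)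

theorem scaleVec_pos {n : ℕ} {ν : Fin n → ℝ} (hν : ∀ i, 0 < ν i) {s : ℝ}
    (hs : s ∈ Set.Ioo (0 : ℝ) 1) (i : Fin n) : 0 < scaleVec ν s i :=
  div_pos (cdf_chiSqQuantile (hν i) hs).1 (hν i)

/-- The cdf is a left inverse of the quantile. Injectivity is what makes Cauchy-Schwarz strict later
on. -/
theorem scaleVec_injOn {n : ℕ} {ν : Fin n → ℝ} (hν : ∀ i, 0 < ν i) (i : Fin n) :
    Set.InjOn (fun s => scaleVec ν s i) (Set.Ioo (0 : ℝ) 1) := by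
  intro s hs t ht h
  have h' : chiSqQuantile (ν i) s = chiSqQuantile (ν i) t :=
    (div_left_inj' (hν i).ne').1 h
  rw [← (cdf_chiSqQuantile (hν i) hs).2, h', (cdf_chiSqQuantile (hν i) ht).2]

/-- The open square `(0, 1)²`. -/
def openSquare : Set (ℝ × ℝ) := Set.Ioo 0 1 ×ˢ Set.Ioo 0 1

theorem measurableSet_openSquare : MeasurableSet openSquare :=
  measurableSet_Ioo.prod measurableSet_Ioo

/-- Removes the boundary, where scale factors degenerate to 0 and inverse matrices take default
values. -/
theorem openSquare_ae_eq_unitSquare : openSquare =ᵐ[volume] unitSquare := by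
  rw [Measure.volume_eq_prod]
  exact Measure.set_prod_ae_eq Ioo_ae_eq_Icc Ioo_ae_eq_Icc

/-! ### Schur complements and positive definiteness -/

section Matrices

variable {n l : Type*} [Fintype n] [DecidableEq n] [Fintype l] [DecidableEq l]

/-- The Schur complement `A - A W (σ Γ + Wᵀ A W)⁻¹ Wᵀ A` is positive definite. -/
theorem posDef_sub_mul_inv_mul {A : Matrix n n ℝ} {Γ : Matrix l l ℝ} (hA : A.PosDef)
    (hΓ : Γ.PosDef) (W : Matrix n l ℝ) :
    (Γ + Wᵀ * A * W).PosDef ∧ (A - A * W * (Γ + Wᵀ * A * W)⁻¹ * Wᵀ * A).PosDef := by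
  have hM : (Γ + Wᵀ * A * W).PosDef := by
    have := hA.posSemidef.conjTranspose_mul_mul_same W
    rw [Matrix.conjTranspose_eq_transpose_of_trivial] at this
    exact hΓ.add_posSemidef this
  refine ⟨hM, ?_⟩
  have hAt : Aᵀ = A := by simpa [Matrix.IsHermitian] using hA.isHermitian
  have hMt : (Γ + Wᵀ * A * W)ᵀ = Γ + Wᵀ * A * W := by
    simpa [Matrix.IsHermitian] using hM.isHermitian
  set Mi := (Γ + Wᵀ * A * W)⁻¹ with hMi
  have hMit : Miᵀ = Mi := by rw [hMi, Matrix.transpose_nonsing_inv, hMt]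
  have hMM : Mi * (Γ + Wᵀ * A * W) = 1 :=
    Matrix.nonsing_inv_mul _ ((Matrix.isUnit_iff_isUnit_det _).1 hM.isUnit)
  set K := Mi * Wᵀ * A with hK
  have hKt : Kᵀ = A * W * Mi := by
    simp [hK, Matrix.transpose_mul, hAt, hMit, Matrix.mul_assoc]
  -- The quadratic form of the Schur complement at `y` is the minimum over `x` of |y - Wx|² in the
  -- metric `A` plus |x|² in the metric `Γ`. The minimiser is `K y`, and this identity evaluates the
  -- sum there.
  have hform : A - A * W * Mi * Wᵀ * A = (1 - W * K)ᵀ * A * (1 - W * K) + Kᵀ * Γ * K := by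
    have h1 : Kᵀ * (Γ + Wᵀ * A * W) = A * W := by
      rw [hKt, Matrix.mul_assoc (A * W), hMM, Matrix.mul_one]
    have h2 : Kᵀ * Γ = A * W - Kᵀ * Wᵀ * A * W := by
      rw [← h1]; simp only [Matrix.mul_add, Matrix.mul_assoc]; abel
    rw [h2]
    simp only [Matrix.transpose_sub, Matrix.transpose_one, Matrix.transpose_mul, Matrix.sub_mul,
      Matrix.mul_sub, Matrix.one_mul, Matrix.mul_one, hK, Matrix.mul_assoc, hAt, hMit,
      Matrix.transpose_transpose]
    abel
  have hP1 : ((1 - W * K)ᵀ * A * (1 - W * K)).PosSemidef := by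
    have := hA.posSemidef.conjTranspose_mul_mul_same (1 - W * K)
    rwa [Matrix.conjTranspose_eq_transpose_of_trivial] at this
  have hP2 : (Kᵀ * Γ * K).PosSemidef := by
    have := hΓ.posSemidef.conjTranspose_mul_mul_same K
    rwa [Matrix.conjTranspose_eq_transpose_of_trivial] at this
  rw [hform]
  refine Matrix.PosDef.of_dotProduct_mulVec_pos (hP1.add hP2).isHermitian fun x hx => ?_
  have e1 : star x ⬝ᵥ (((1 - W * K)ᵀ * A * (1 - W * K)) *ᵥ x) =
      star ((1 - W * K) *ᵥ x) ⬝ᵥ (A *ᵥ ((1 - W * K) *ᵥ x)) := by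
    simp only [star_trivial, ← Matrix.mulVec_mulVec, Matrix.dotProduct_mulVec,
      Matrix.vecMul_transpose]
  have e2 : star x ⬝ᵥ ((Kᵀ * Γ * K) *ᵥ x) = star (K *ᵥ x) ⬝ᵥ (Γ *ᵥ (K *ᵥ x)) := by
    simp only [star_trivial, ← Matrix.mulVec_mulVec, Matrix.dotProduct_mulVec,
      Matrix.vecMul_transpose]
  rw [Matrix.add_mulVec, dotProduct_add]
  -- The two squares cannot vanish together: if `K x = 0`, the first one is the `A`-norm of `x`
  -- itself.
  by_cases hk : K *ᵥ x = 0
  · have hx' : (1 - W * K) *ᵥ x = x := by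
      rw [Matrix.sub_mulVec, ← Matrix.mulVec_mulVec, hk]; simp
    refine add_pos_of_pos_of_nonneg ?_ (hP2.dotProduct_mulVec_nonneg x)
    rw [e1, hx']
    exact hA.dotProduct_mulVec_pos hx
  · refine add_pos_of_nonneg_of_pos (hP1.dotProduct_mulVec_nonneg x) ?_
    rw [e2]
    exact hΓ.dotProduct_mulVec_pos hk

/-- The conditional covariance of the block outside `p` given the block `p`. -/
theorem posSemidef_schur_submatrix {A : Matrix n n ℝ} (hA : A.PosDef) (p : n → Prop)
    [Fintype {i // p i}] [Fintype {i // ¬ p i}] :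
    (A.submatrix (Subtype.val : {i // ¬ p i} → n) (Subtype.val : {i // ¬ p i} → n) -
      A.submatrix (Subtype.val : {i // ¬ p i} → n) (Subtype.val : {i // p i} → n) *
      (A.submatrix (Subtype.val : {i // p i} → n) (Subtype.val : {i // p i} → n))⁻¹ *
      A.submatrix (Subtype.val : {i // p i} → n)
        (Subtype.val : {i // ¬ p i} → n)).PosSemidef := by
  have hoo : (A.submatrix (Subtype.val : {i // p i} → n) Subtype.val).PosDef :=
    hA.submatrix Subtype.val_injective
  have hB : (A.submatrix (Subtype.val : {i // ¬ p i} → n) (Subtype.val : {i // p i} → n)) =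
      (A.submatrix (Subtype.val : {i // p i} → n) (Subtype.val : {i // ¬ p i} → n))ᴴ := by
    rw [Matrix.conjTranspose_submatrix, hA.isHermitian.eq]
  rw [hB]
  have : Invertible (A.submatrix (Subtype.val : {i // p i} → n) Subtype.val) :=
    hoo.isUnit.invertible
  -- The Schur complement is positive semidefinite as soon as the block matrix is, and the block
  -- matrix is `A` with the indices in `p` listed first.
  rw [← Matrix.PosDef.fromBlocks₁₁ _ _ hoo, ← hB]
  have hblocks : Matrix.fromBlocks (A.submatrix (Subtype.val : {i // p i} → n) Subtype.val)
      (A.submatrix (Subtype.val : {i // p i} → n) (Subtype.val : {i // ¬ p i} → n))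
      (A.submatrix (Subtype.val : {i // ¬ p i} → n) (Subtype.val : {i // p i} → n))
      (A.submatrix (Subtype.val : {i // ¬ p i} → n) Subtype.val) =
      A.submatrix (Sum.elim (Subtype.val : {i // p i} → n) (Subtype.val : {i // ¬ p i} → n))
        (Sum.elim (Subtype.val : {i // p i} → n) (Subtype.val : {i // ¬ p i} → n)) := by
    ext i j
    rcases i with i | i <;> rcases j with j | j <;> rfl
  rw [hblocks]
  exact hA.posSemidef.submatrix _

end Matrices

/-! ### Positivity of the model matrices and densities on the open square -/

section Model

variable {d k N : ℕ} {D : Data d k N} {P : Param d k} {s : ℝ × ℝ}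

theorem posDef_Deps (hnu : ∀ i, 0 < D.nuEps i) (hs : s ∈ openSquare) : (Deps D s).PosDef :=
  Matrix.PosDef.diagonal fun i => scaleVec_pos hnu hs.1 i

theorem posDef_Dx (hnu : ∀ i, 0 < D.nuX i) (hs : s ∈ openSquare) : (Dx D s).PosDef :=
  Matrix.PosDef.diagonal fun i => scaleVec_pos hnu hs.2 i

theorem posDef_M_Nmat (hnuEps : ∀ i, 0 < D.nuEps i) (hnuX : ∀ j, 0 < D.nuX j)
    (hP : 0 < P.sigma2) (hs : s ∈ openSquare) : (M D P s).PosDef ∧ (Nmat D P s).PosDef :=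
  posDef_sub_mul_inv_mul (posDef_Deps hnuEps hs) ((posDef_Dx hnuX hs).smul hP) P.W

theorem posDef_SigmaY (hnuEps : ∀ i, 0 < D.nuEps i) (hnuX : ∀ j, 0 < D.nuX j)
    (hP : 0 < P.sigma2) (hs : s ∈ openSquare) : (SigmaY D P s).PosDef :=
  (posDef_M_Nmat hnuEps hnuX hP hs).2.inv.smul hP

theorem densO_pos (hnuEps : ∀ i, 0 < D.nuEps i) (hnuX : ∀ j, 0 < D.nuX j)
    (hP : 0 < P.sigma2) (hs : s ∈ openSquare) (t : Fin N) : 0 < densO D P t s := by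
  have h : (SigmaOO D P t s).PosDef :=
    (posDef_SigmaY hnuEps hnuX hP hs).submatrix Subtype.val_injective
  have := h.det_pos
  unfold densO
  positivity

theorem m_pos (hnuEps : ∀ i, 0 < D.nuEps i) (hnuX : ∀ j, 0 < D.nuX j)
    (hP : 0 < P.sigma2) (hs : s ∈ openSquare) (t : Fin N) : 0 < m D P t s := by
  have h1 := densO_pos hnuEps hnuX hP hs t
  have h2 := (posDef_Deps hnuEps hs).det_pos
  have h3 := (posDef_Dx hnuX hs).det_pos
  have h4 := (posDef_M_Nmat hnuEps hnuX hP hs).1.det_pos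
  have h5 := (posDef_M_Nmat hnuEps hnuX hP hs).2.det_pos
  unfold m
  positivity

/-- The covariance matrix of `Y_t` given `Y_t^o` and the scale variables. -/
noncomputable def condCov (D : Data d k N) (P : Param d k) (t : Fin N) (s : ℝ × ℝ) :
    Matrix (Fin d) (Fin d) ℝ :=
  Matrix.of fun i j =>
    if hi : i ∈ D.obs t then 0 else
      if hj : j ∈ D.obs t then 0 else SigmaTilde D P t s ⟨i, hi⟩ ⟨j, hj⟩

theorem posSemidef_condCov (hnuEps : ∀ i, 0 < D.nuEps i) (hnuX : ∀ j, 0 < D.nuX j)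
    (hP : 0 < P.sigma2) (hs : s ∈ openSquare) (t : Fin N) : (condCov D P t s).PosSemidef := by
  have h : (SigmaTilde D P t s).PosSemidef :=
    posSemidef_schur_submatrix (posDef_SigmaY hnuEps hnuX hP hs) (fun i => i ∈ D.obs t)
  -- `B` embeds the missing coordinates into all coordinates; extension of a matrix by zero is
  -- conjugation by `B`.
  let B : Matrix (Fin d) (Mis D t) ℝ := Matrix.of fun i j => if i = j.1 then 1 else 0
  have : condCov D P t s = B * SigmaTilde D P t s * Bᴴ := by
    ext i j
    by_cases hi : i ∈ D.obs t
    · have : ∀ x : Mis D t, i ≠ x.1 := fun x hx => x.2 (hx ▸ hi)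
      simp [condCov, hi, B, Matrix.mul_apply, this]
    · by_cases hj : j ∈ D.obs t
      · have : ∀ x : Mis D t, j ≠ x.1 := fun x hx => x.2 (hx ▸ hj)
        simp [condCov, hj, B, Matrix.mul_apply, this]
      · have h1 : ∀ x : Mis D t, i = x.1 ↔ (⟨i, hi⟩ : Mis D t) = x := fun x => by
          rw [Subtype.ext_iff]
        have h2 : ∀ x : Mis D t, j = x.1 ↔ (⟨j, hj⟩ : Mis D t) = x := fun x => by
          rw [Subtype.ext_iff]
        simp [condCov, hi, hj, B, Matrix.mul_apply, h1, h2]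
  rw [this]
  exact h.mul_mul_conjTranspose_same B

end Model

/-! ### Integrals over the square and their linear extension -/

theorem setIntegral_unitSquare (g : ℝ × ℝ → ℝ) :
    ∫ s in unitSquare, g s = ∫ s in openSquare, g s :=
  (setIntegral_congr_set openSquare_ae_eq_unitSquare).symm

theorem setIntegral_unitSquare_nonneg {g : ℝ × ℝ → ℝ} (h : ∀ s ∈ openSquare, 0 ≤ g s) :
    0 ≤ ∫ s in unitSquare, g s := by
  rw [setIntegral_unitSquare]
  exact setIntegral_nonneg measurableSet_openSquare h

/-- The exceptional null set `Z` accommodates the square in the Cauchy-Schwarz argument, which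
vanishes on a level set of one scale factor. -/
theorem setIntegral_unitSquare_pos {g : ℝ × ℝ → ℝ} (hg : IntegrableOn g unitSquare)
    (Z : Set (ℝ × ℝ)) (hZ : volume Z = 0) (h0 : ∀ s ∈ openSquare, 0 ≤ g s)
    (h : ∀ s ∈ openSquare, s ∉ Z → 0 < g s) :
    0 < ∫ s in unitSquare, g s := by
  have hg' : IntegrableOn g openSquare := hg.congr_set_ae openSquare_ae_eq_unitSquare
  rw [setIntegral_unitSquare, setIntegral_pos_iff_support_of_nonneg_ae
    ((ae_restrict_mem measurableSet_openSquare).mono h0) hg']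
  have hvol : 0 < volume (openSquare \ Z) := by
    rw [measure_sdiff_null hZ, openSquare, Measure.volume_eq_prod, Measure.prod_prod]
    simp
  exact hvol.trans_le (measure_mono fun s hs => ⟨(h s hs.1 hs.2).ne', hs.1⟩)

variable {d k N : ℕ}

/-- The functional `F ↦ ∑_t H_t ∫∫ F_t m_t`, extended linearly from the functions on the open
square for which it converges to all functions. -/
theorem exists_linear_extension (D : Data d k N) (P : Param d k) :
    ∃ Λ : (Fin N × openSquare → ℝ) →ₗ[ℝ] ℝ, ∀ F : Fin N → ℝ × ℝ → ℝ,
      (∀ t, IntegrableOn (fun s => F t s * m D P t s) unitSquare) →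
        Λ (fun x => F x.1 x.2) = ∑ t, H D P t * ∫ s in unitSquare, F t s * m D P t s := by
  -- Functions live on the subtype so that identities requiring invertible `D_ε`, `D_x` become
  -- equalities of functions.
  let ρ : Measure openSquare := Measure.comap Subtype.val volume
  let V : Submodule ℝ (Fin N × openSquare → ℝ) :=
    { carrier := {F | ∀ t, Integrable (fun s : openSquare => F (t, s) * m D P t s) ρ}
      add_mem' := fun {F G} hF hG t => by
        simp only [Pi.add_apply, add_mul]
        exact (hF t).add (hG t)
      zero_mem' := fun t => by simp
      smul_mem' := fun c F hF t => by
        simpa only [Pi.smul_apply, smul_eq_mul, mul_assoc] using (hF t).const_mul c }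
  let Λ₀ : V →ₗ[ℝ] ℝ :=
    { toFun := fun F => ∑ t, H D P t * ∫ s : openSquare, F.1 (t, s) * m D P t s ∂ρ
      map_add' := fun F G => by
        rw [← Finset.sum_add_distrib]
        refine Finset.sum_congr rfl fun t _ => ?_
        rw [← mul_add, ← integral_add (F.2 t) (G.2 t)]
        simp only [Submodule.coe_add, Pi.add_apply, add_mul]
      map_smul' := fun c F => by
        simp only [Submodule.coe_smul, Pi.smul_apply, smul_eq_mul, mul_assoc, integral_const_mul,
          RingHom.id_apply, Finset.mul_sum]
        exact Finset.sum_congr rfl fun t _ => by ring }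
  -- Outside `V` the values are an arbitrary choice: Λ is linear but not known to be positive, so
  -- every inequality must come from a convergent integral.
  obtain ⟨Λ, hΛ⟩ := Λ₀.exists_extend
  refine ⟨Λ, fun F hF => ?_⟩
  have hmem : (fun x : Fin N × openSquare => F x.1 x.2) ∈ V := fun t => by
    have h : IntegrableOn (fun s => F t s * m D P t s) openSquare :=
      (hF t).congr_set_ae openSquare_ae_eq_unitSquare
    exact (integrableOn_iff_comap_subtypeVal measurableSet_openSquare).1 h
  have h1 : Λ (fun x => F x.1 x.2) = Λ₀ ⟨_, hmem⟩ := LinearMap.congr_fun hΛ ⟨_, hmem⟩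
  rw [h1]
  change ∑ t, H D P t * ∫ s : openSquare, F t s * m D P t s ∂ρ = _
  refine Finset.sum_congr rfl fun t _ => ?_
  rw [setIntegral_unitSquare]
  congr 1
  exact integral_subtype_comap measurableSet_openSquare (fun s => F t s * m D P t s)

/-- A linear functional applied to the entries of a matrix-valued function. -/
def mapEntries {X : Type*} (Λ : (X → ℝ) →ₗ[ℝ] ℝ) {ι κ : Type*} (F : X → Matrix ι κ ℝ) :
    Matrix ι κ ℝ := Matrix.of fun i j => Λ fun x => F x i j

/-! ### Entrywise application of a linear functional to matrices -/

section mapEntries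

variable {X : Type*} (Λ : (X → ℝ) →ₗ[ℝ] ℝ) {ι κ τ : Type*}

theorem map_fun_add (F G : X → ℝ) : Λ (fun x => F x + G x) = Λ F + Λ G := map_add Λ F G

theorem map_fun_sub (F G : X → ℝ) : Λ (fun x => F x - G x) = Λ F - Λ G := map_sub Λ F G

theorem map_fun_mul (c : ℝ) (F : X → ℝ) : Λ (fun x => c * F x) = c * Λ F := map_smul Λ c F

theorem mapEntries_apply (F : X → Matrix ι κ ℝ) (i : ι) (j : κ) :
    mapEntries Λ F i j = Λ fun x => F x i j := rfl

theorem mapEntries_add (F G : X → Matrix ι κ ℝ) :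
    mapEntries Λ (fun x => F x + G x) = mapEntries Λ F + mapEntries Λ G := by
  ext i j; exact map_add Λ (fun x => F x i j) (fun x => G x i j)

theorem mapEntries_sub (F G : X → Matrix ι κ ℝ) :
    mapEntries Λ (fun x => F x - G x) = mapEntries Λ F - mapEntries Λ G := by
  ext i j; exact map_sub Λ (fun x => F x i j) (fun x => G x i j)

theorem mapEntries_smul (c : ℝ) (F : X → Matrix ι κ ℝ) :
    mapEntries Λ (fun x => c • F x) = c • mapEntries Λ F := by
  ext i j; exact map_smul Λ c (fun x => F x i j)

theorem mapEntries_transpose (F : X → Matrix ι κ ℝ) :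
    mapEntries Λ (fun x => (F x)ᵀ) = (mapEntries Λ F)ᵀ := rfl

/-- The source of the factors `A_0` in front of μ* and δ_ε*. -/
theorem mapEntries_const (C : Matrix ι κ ℝ) :
    mapEntries Λ (fun _ => C) = Λ (fun _ => 1) • C := by
  ext i j
  have : (fun _ : X => C i j) = C i j • (fun _ => (1 : ℝ)) := by ext; simp
  rw [mapEntries_apply, this, map_smul, Matrix.smul_apply, smul_eq_mul, smul_eq_mul, mul_comm]

theorem mapEntries_mul_left [Fintype ι] (C : Matrix τ ι ℝ) (F : X → Matrix ι κ ℝ) :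
    mapEntries Λ (fun x => C * F x) = C * mapEntries Λ F := by
  ext i j
  have : (fun x => (C * F x) i j) = ∑ a, C i a • fun x => F x a j := by
    ext x; simp [Matrix.mul_apply]
  rw [mapEntries_apply, this, map_sum, Matrix.mul_apply]
  simp only [map_smul, smul_eq_mul, mapEntries_apply]

theorem mapEntries_mul_right [Fintype κ] (F : X → Matrix ι κ ℝ) (C : Matrix κ τ ℝ) :
    mapEntries Λ (fun x => F x * C) = mapEntries Λ F * C := by
  ext i j
  have : (fun x => (F x * C) i j) = ∑ a, C a j • fun x => F x i a := by
    ext x; simp [Matrix.mul_apply, mul_comm]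
  rw [mapEntries_apply, this, map_sum, Matrix.mul_apply]
  simp only [map_smul, smul_eq_mul, mapEntries_apply, mul_comm]

theorem map_trace [Fintype ι] (F : X → Matrix ι ι ℝ) :
    Λ (fun x => (F x).trace) = (mapEntries Λ F).trace := by
  have : (fun x => (F x).trace) = ∑ i, fun x => F x i i := by
    ext x; simp [Matrix.trace]
  rw [this, map_sum]; rfl

end mapEntries

/-! ### Trace identities for the expected squared residual -/

section Algebra

variable {n l r : Type*} [Fintype n] [Fintype l] [Fintype r]

/-- The expansion of the weighted conditional second moment of
`y - μ - x wᵀ - δ D⁻¹`, where `y` has mean `E` and covariance `R`, and `x` given `y` has mean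
`e + (y - E) G` and covariance `c • Γ`. -/
theorem trace_residual_expand [DecidableEq n] {D Di R : Matrix n n ℝ} {Γ : Matrix l l ℝ}
    (hD : Dᵀ = D) (hDi : Di * D = 1) (hDit : Diᵀ = Di) (hR : Rᵀ = R)
    (E μ δ : Matrix r n ℝ) (e : Matrix r l ℝ) (w G : Matrix n l ℝ) (c : ℝ) :
    ((E - (μ + e * wᵀ + δ * Di)) * D * (E - (μ + e * wᵀ + δ * Di))ᵀ).trace
      + ((1 - w * Gᵀ) * R * (1 - w * Gᵀ)ᵀ * D).trace + c * (w * Γ * wᵀ * D).trace =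
    (R * D).trace - 2 * (R * G * wᵀ * D).trace + (Gᵀ * R * G * (wᵀ * D * w)).trace
      + c * (Γ * (wᵀ * D * w)).trace
      + (E * D * Eᵀ).trace - 2 * (E * D * μᵀ).trace - 2 * (E * δᵀ).trace
      + (μ * D * μᵀ).trace + 2 * (μ * δᵀ).trace + (δ * Di * δᵀ).trace
      - 2 * (E * D * w * eᵀ).trace + 2 * (e * wᵀ * D * μᵀ).trace + 2 * (e * wᵀ * δᵀ).trace
      + (e * (wᵀ * D * w) * eᵀ).trace := by
  have hDD : D * Di = 1 := by
    have := congrArg Matrix.transpose hDi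
    rwa [Matrix.transpose_mul, hD, hDit, Matrix.transpose_one] at this
  have hDD' : ∀ X : Matrix n r ℝ, D * (Di * X) = X := fun X => by
    rw [← Matrix.mul_assoc, hDD, Matrix.one_mul]
  have hDi' : ∀ X : Matrix n r ℝ, Di * (D * X) = X := fun X => by
    rw [← Matrix.mul_assoc, hDi, Matrix.one_mul]
  have tr : ∀ {a b : Type _} [Fintype a] [Fintype b] (A : Matrix a b ℝ) (B : Matrix a b ℝ),
      (A * Bᵀ).trace = (B * Aᵀ).trace := fun A B => by
    rw [← Matrix.trace_transpose, Matrix.transpose_mul, Matrix.transpose_transpose]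
  have h1 := tr μ (E * D)
  have h2 := tr (e * wᵀ) (E * D)
  have h3 := tr δ E
  have h4 := tr (μ * D) (e * wᵀ)
  have h5 := tr δ μ
  have h6 := tr δ (e * wᵀ)
  -- Each cross term occurs twice, once transposed. Once all products are bracketed to the right,
  -- these transpositions and cyclic shifts make the claim linear in the remaining traces.
  have h7 : (w * Gᵀ * R * D).trace = (R * G * wᵀ * D).trace := by
    rw [Matrix.trace_mul_comm, ← Matrix.trace_transpose]
    simp only [Matrix.transpose_mul, Matrix.transpose_transpose, hD, hR, Matrix.mul_assoc]
  have h8 : (w * Gᵀ * R * G * wᵀ * D).trace = (Gᵀ * R * G * (wᵀ * D * w)).trace := by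
    have := Matrix.trace_mul_comm w (Gᵀ * R * G * wᵀ * D)
    simpa only [Matrix.mul_assoc] using this
  have h9 : (w * Γ * wᵀ * D).trace = (Γ * (wᵀ * D * w)).trace := by
    have := Matrix.trace_mul_comm w (Γ * wᵀ * D)
    simpa only [Matrix.mul_assoc] using this
  rw [h9]
  simp only [Matrix.transpose_add, Matrix.transpose_sub, Matrix.transpose_mul,
    Matrix.transpose_one, Matrix.transpose_transpose, Matrix.mul_add, Matrix.mul_sub,
    Matrix.add_mul, Matrix.sub_mul, Matrix.trace_add, Matrix.trace_sub, Matrix.mul_one,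
    Matrix.one_mul, Matrix.mul_assoc, hD, hDit, hR, hDD', hDi'] at *
  linarith

/-- Specialises `trace_residual_expand` to the regression of the model, where `Γ` plays the role of
`M⁻¹`, `c` that of σ², and `EE` of the full second moment. The right-hand side is -2σ*² times the
part of `v` carrying the factor 1/σ*². -/
theorem trace_EM_numerator [DecidableEq n] {D Di R EE : Matrix n n ℝ} {Γ : Matrix l l ℝ}
    (hD : Dᵀ = D) (hDi : Di * D = 1) (hDit : Diᵀ = Di) (hR : Rᵀ = R) (hΓ : Γᵀ = Γ)
    (E μ δ : Matrix r n ℝ) (b : Matrix r l ℝ) (w W : Matrix n l ℝ) (c : ℝ)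
    (hEE : EE = R + Eᵀ * E) :
    ((E - (μ + (E * D * W * Γ - b * Γ) * wᵀ + δ * Di)) * D *
        (E - (μ + (E * D * W * Γ - b * Γ) * wᵀ + δ * Di))ᵀ).trace
      + ((1 - w * (Γ * Wᵀ * D)) * R * (1 - w * (Γ * Wᵀ * D))ᵀ * D).trace
      + c * (w * Γ * wᵀ * D).trace =
    (EE * D).trace - 2 * (E * (D * μᵀ + δᵀ)).trace + (μ * D * μᵀ).trace + 2 * (μ * δᵀ).trace
      + (δ * Di * δᵀ).trace - 2 * (EE * D * W * Γ * wᵀ * D).trace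
      + 2 * (E * D * W * Γ * (wᵀ * D * μᵀ + wᵀ * δᵀ)).trace
      + 2 * (b * Γ * wᵀ * D * Eᵀ).trace
      - 2 * (b * Γ * (wᵀ * D * μᵀ + wᵀ * δᵀ)).trace
      + (Γ * Wᵀ * D * EE * D * W * Γ * (wᵀ * D * w)).trace
      - 2 * (Γ * Wᵀ * D * Eᵀ * b * Γ * (wᵀ * D * w)).trace
      + (Γ * bᵀ * b * Γ * (wᵀ * D * w)).trace + c * (Γ * (wᵀ * D * w)).trace := by
  have hG : Γ * Wᵀ * D = (D * W * Γ)ᵀ := by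
    simp only [Matrix.transpose_mul, hD, hΓ, Matrix.mul_assoc]
  have key := trace_residual_expand (Γ := Γ) hD hDi hDit hR E μ δ (E * D * W * Γ - b * Γ) w
    (D * W * Γ) c
  rw [← hG] at key
  rw [key, hEE]
  have h1 : (Eᵀ * E * D).trace = (E * D * Eᵀ).trace := by
    rw [Matrix.mul_assoc, Matrix.trace_mul_comm]
  have h2 : (Eᵀ * E * D * W * Γ * wᵀ * D).trace = (E * D * w * (E * D * W * Γ)ᵀ).trace := by
    rw [← Matrix.trace_transpose (E * D * w * (E * D * W * Γ)ᵀ)]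
    have := Matrix.trace_mul_comm Eᵀ (E * D * W * Γ * wᵀ * D)
    simpa only [Matrix.transpose_mul, Matrix.transpose_transpose, Matrix.mul_assoc, hD, hΓ]
      using this
  have h3 : (b * Γ * wᵀ * D * Eᵀ).trace = (E * D * w * (b * Γ)ᵀ).trace := by
    rw [← Matrix.trace_transpose (E * D * w * (b * Γ)ᵀ)]
    simp only [Matrix.transpose_mul, Matrix.transpose_transpose, Matrix.mul_assoc, hD, hΓ]
  have h4 : (Γ * Wᵀ * D * (Eᵀ * E) * D * W * Γ * (wᵀ * D * w)).trace =
      (E * D * W * Γ * (wᵀ * D * w) * (E * D * W * Γ)ᵀ).trace := by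
    have := Matrix.trace_mul_comm (Γ * Wᵀ * D * Eᵀ) (E * D * W * Γ * (wᵀ * D * w))
    simpa only [Matrix.transpose_mul, Matrix.transpose_transpose, Matrix.mul_assoc, hD, hΓ]
      using this
  have h5 : (Γ * Wᵀ * D * Eᵀ * b * Γ * (wᵀ * D * w)).trace =
      (b * Γ * (wᵀ * D * w) * (E * D * W * Γ)ᵀ).trace := by
    have := Matrix.trace_mul_comm (Γ * Wᵀ * D * Eᵀ) (b * Γ * (wᵀ * D * w))
    simpa only [Matrix.transpose_mul, Matrix.transpose_transpose, Matrix.mul_assoc, hD, hΓ]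
      using this
  have h6 : (E * D * W * Γ * (wᵀ * D * w) * (b * Γ)ᵀ).trace =
      (b * Γ * (wᵀ * D * w) * (E * D * W * Γ)ᵀ).trace := by
    rw [← Matrix.trace_transpose (b * Γ * (wᵀ * D * w) * (E * D * W * Γ)ᵀ)]
    simp only [Matrix.transpose_mul, Matrix.transpose_transpose, Matrix.mul_assoc, hD, hΓ]
  have h7 : (Γ * bᵀ * b * Γ * (wᵀ * D * w)).trace =
      (b * Γ * (wᵀ * D * w) * (b * Γ)ᵀ).trace := by
    have := Matrix.trace_mul_comm (Γ * bᵀ) (b * Γ * (wᵀ * D * w))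
    simpa only [Matrix.transpose_mul, Matrix.transpose_transpose, Matrix.mul_assoc, hD, hΓ]
      using this
  simp only [Matrix.transpose_add, Matrix.transpose_sub, Matrix.transpose_mul,
    Matrix.transpose_transpose, Matrix.mul_add, Matrix.mul_sub,
    Matrix.add_mul, Matrix.sub_mul, Matrix.trace_add, Matrix.trace_sub,
    Matrix.mul_assoc, hD, hΓ] at *
  linarith

/-- The same quantity in terms of the integrands of `A_0, …, A_21`. -/
theorem trace_EM_sigma2 {D Di EE : Matrix n n ℝ} {Γ : Matrix l l ℝ} (hD : Dᵀ = D)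
    (hEEt : EEᵀ = EE) (hΓ : Γᵀ = Γ) (E μ δ μ₀ : Matrix r n ℝ) (b v : Matrix r l ℝ)
    (w W : Matrix n l ℝ) (c : ℝ) (hb : b = μ₀ * D * W + v) :
    (EE * D).trace - 2 * (E * (D * μᵀ + δᵀ)).trace + (μ * D * μᵀ).trace + 2 * (μ * δᵀ).trace
      + (δ * Di * δᵀ).trace - 2 * (EE * D * W * Γ * wᵀ * D).trace
      + 2 * (E * D * W * Γ * (wᵀ * D * μᵀ + wᵀ * δᵀ)).trace
      + 2 * (b * Γ * wᵀ * D * Eᵀ).trace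
      - 2 * (b * Γ * (wᵀ * D * μᵀ + wᵀ * δᵀ)).trace
      + (Γ * Wᵀ * D * EE * D * W * Γ * (wᵀ * D * w)).trace
      - 2 * (Γ * Wᵀ * D * Eᵀ * b * Γ * (wᵀ * D * w)).trace
      + (Γ * bᵀ * b * Γ * (wᵀ * D * w)).trace + c * (Γ * (wᵀ * D * w)).trace =
    (EE * D).trace + (μ * D * μᵀ).trace + (δ * Di * δᵀ).trace
      + 2 * (E * D * w * Γ * Wᵀ * D * μ₀ᵀ).trace
      + 2 * ((E * D * W * Γ * wᵀ * D - E * D - μ₀ * (D * W * Γ * wᵀ * D)) * μᵀ).trace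
      - 2 * (EE * D * W * Γ * wᵀ * D).trace
      + c * ((D * w * Γ)ᵀ * w).trace
      + ((D * w * Γ * Wᵀ * D * EE * D * W * Γ)ᵀ * w).trace
      - ((D * w * Γ * Wᵀ * D * Eᵀ * b * Γ)ᵀ * w).trace
      - ((D * w * Γ * bᵀ * E * D * W * Γ)ᵀ * w).trace
      + ((D * w * Γ * bᵀ * b * Γ)ᵀ * w).trace
      + 2 * ((μ - E + E * D * W * Γ * wᵀ - μ₀ * (D * W * Γ) * wᵀ) * δᵀ).trace
      + 2 * ((E * D * w * Γ - μ * (D * w * Γ) - δ * w * Γ) * vᵀ).trace := by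
  have tr : ∀ (A B : Matrix r l ℝ), (A * Bᵀ).trace = (B * Aᵀ).trace := fun A B => by
    rw [← Matrix.trace_transpose, Matrix.transpose_mul, Matrix.transpose_transpose]
  have h1 : (b * Γ * wᵀ * D * Eᵀ).trace =
      (E * D * w * Γ * Wᵀ * D * μ₀ᵀ).trace + (E * D * w * Γ * vᵀ).trace := by
    rw [← Matrix.trace_transpose, hb]
    simp only [Matrix.transpose_mul, Matrix.transpose_transpose, Matrix.transpose_add,
      Matrix.mul_add, Matrix.trace_add, Matrix.mul_assoc, hD, hΓ]
  have h2 : (b * Γ * (wᵀ * D * μᵀ)).trace =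
      (μ₀ * (D * W * Γ * wᵀ * D) * μᵀ).trace + (μ * (D * w * Γ) * vᵀ).trace := by
    rw [tr (μ * (D * w * Γ)) v, hb]
    simp only [Matrix.transpose_mul, Matrix.add_mul, Matrix.trace_add, Matrix.mul_assoc, hD, hΓ]
  have h3 : (b * Γ * (wᵀ * δᵀ)).trace =
      (μ₀ * (D * W * Γ) * wᵀ * δᵀ).trace + (δ * w * Γ * vᵀ).trace := by
    rw [tr (δ * w * Γ) v, hb]
    simp only [Matrix.transpose_mul, Matrix.add_mul, Matrix.trace_add, Matrix.mul_assoc, hΓ]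
  -- The integrands of `A_18.1` and `A_18.2` have the same trace against `w`; together they account
  -- for the cross term with coefficient 2.
  have h4 : (Γ * bᵀ * E * D * W * Γ * (wᵀ * D * w)).trace =
      (Γ * Wᵀ * D * Eᵀ * b * Γ * (wᵀ * D * w)).trace := by
    rw [← Matrix.trace_transpose]
    have := Matrix.trace_mul_comm (wᵀ * D * w) (Γ * Wᵀ * D * Eᵀ * b * Γ)
    simpa only [Matrix.transpose_mul, Matrix.transpose_transpose, Matrix.mul_assoc, hD, hΓ]
      using this
  simp only [Matrix.transpose_mul, Matrix.transpose_transpose, Matrix.mul_add,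
    Matrix.add_mul, Matrix.sub_mul, Matrix.trace_add, Matrix.trace_sub,
    Matrix.mul_assoc, hD, hΓ, hEEt] at *
  linarith

end Algebra

/-! ### Derivative and global maximum of a Gaussian log-likelihood shape -/

section Calculus

variable {E : Type*} [NormedAddCommGroup E] [NormedSpace ℝ E] [FiniteDimensional ℝ E]

theorem hasFDerivAt_bilin_self (b : E →ₗ[ℝ] E →ₗ[ℝ] ℝ) (hb : ∀ x y, b x y = b y x) (x : E) :
    HasFDerivAt (fun y => b y y) (LinearMap.toContinuousLinearMap (2 • b x)) x := by
  have h := (LinearMap.toContinuousBilinearMap b).hasFDerivAt_of_bilinear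
    (hasFDerivAt_id x) (hasFDerivAt_id x)
  refine h.congr_fderiv ?_
  ext y
  simp [two_smul, hb y x]

/-- The derivative of `-α log σ - ½ b₁(x, x) + l₁(x) - (q₀ - 2 l₂(x) + b₂(x, x)) / (2 σ)`,
`σ` a linear form. -/
theorem hasFDerivAt_logGaussian (σ l₁ l₂ : E →ₗ[ℝ] ℝ) (b₁ b₂ : E →ₗ[ℝ] E →ₗ[ℝ] ℝ)
    (hb₁ : ∀ x y, b₁ x y = b₁ y x) (hb₂ : ∀ x y, b₂ x y = b₂ y x) (c α q₀ : ℝ) {x : E}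
    (hx : 0 < σ x) :
    ∃ F' : E →L[ℝ] ℝ, HasFDerivAt (fun y => c - α * Real.log (σ y) - 1 / 2 * b₁ y y + l₁ y
        - 1 / (2 * σ y) * (q₀ - 2 * l₂ y + b₂ y y)) F' x ∧
      ∀ h, F' h = l₁ h - b₁ x h + 1 / σ x * (l₂ h - b₂ x h)
        + ((q₀ - 2 * l₂ x + b₂ x x) - 2 * α * σ x) / (2 * σ x ^ 2) * σ h := by
  have hσ : HasFDerivAt (fun y => σ y) (LinearMap.toContinuousLinearMap σ) x :=
    (LinearMap.toContinuousLinearMap σ).hasFDerivAt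
  have h₁ : HasFDerivAt (fun y => l₁ y) (LinearMap.toContinuousLinearMap l₁) x :=
    (LinearMap.toContinuousLinearMap l₁).hasFDerivAt
  have h₂ : HasFDerivAt (fun y => l₂ y) (LinearMap.toContinuousLinearMap l₂) x :=
    (LinearMap.toContinuousLinearMap l₂).hasFDerivAt
  have hinv : HasFDerivAt (fun y => 1 / (2 * σ y))
      ((-(1 / (2 * σ x ^ 2))) • LinearMap.toContinuousLinearMap σ) x := by
    have hd : HasDerivAt (fun r : ℝ => 1 / (2 * r)) (-(1 / (2 * σ x ^ 2))) (σ x) := by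
      have := (((hasDerivAt_id (σ x)).const_mul 2).inv (by simpa using hx.ne'))
      simp only [one_div]
      convert! this using 1
      simp only [id]
      field_simp
    exact hd.comp_hasFDerivAt x hσ
  have hlog := (hσ.log hx.ne').const_mul α
  have hq := ((h₂.const_mul 2).const_sub q₀).add (hasFDerivAt_bilin_self b₂ hb₂ x)
  have hall := (((hlog.const_sub c).sub ((hasFDerivAt_bilin_self b₁ hb₁ x).const_mul (1 / 2))).add
    h₁).sub (hinv.mul hq)
  refine ⟨_, hall, fun h => ?_⟩
  simp
  field_simp
  ring

omit [FiniteDimensional ℝ E] in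
/-- A critical point of the function in `hasFDerivAt_logGaussian` is a global maximum. -/
theorem logGaussian_le (σ l₁ l₂ : E →ₗ[ℝ] ℝ) (b₁ b₂ : E →ₗ[ℝ] E →ₗ[ℝ] ℝ)
    (hb₁ : ∀ x y, b₁ x y = b₁ y x) (hb₂ : ∀ x y, b₂ x y = b₂ y x)
    (hp₁ : ∀ x, 0 ≤ b₁ x x) (hp₂ : ∀ x, 0 ≤ b₂ x x) {c α q₀ : ℝ} (hα : 0 ≤ α) {x y : E}
    (hx : 0 < σ x) (hy : 0 < σ y) (h₁ : ∀ h, b₁ x h = l₁ h) (h₂ : ∀ h, b₂ x h = l₂ h)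
    (hq : q₀ - 2 * l₂ x + b₂ x x = 2 * α * σ x) :
    c - α * Real.log (σ y) - 1 / 2 * b₁ y y + l₁ y - 1 / (2 * σ y) * (q₀ - 2 * l₂ y + b₂ y y) ≤
      c - α * Real.log (σ x) - 1 / 2 * b₁ x x + l₁ x
        - 1 / (2 * σ x) * (q₀ - 2 * l₂ x + b₂ x x) := by
  -- Completing the square: criticality turns this difference into ½ b₁(y - x, y - x).
  have e₁ : 0 ≤ 1 / 2 * b₁ y y - l₁ y - (1 / 2 * b₁ x x - l₁ x) := by
    have := hp₁ (y - x)
    simp only [map_sub, LinearMap.sub_apply, hb₁ y x] at this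
    rw [← h₁ y, ← h₁ x]
    linarith
  -- The quadratic part is minimal at `x` independently of σ, with minimum fixed by `hq`.
  have e₂ : 2 * α * σ x ≤ q₀ - 2 * l₂ y + b₂ y y := by
    have := hp₂ (y - x)
    simp only [map_sub, LinearMap.sub_apply, hb₂ y x] at this
    rw [← hq, ← h₂ y, ← h₂ x]
    linarith
  have e₃ : 1 / (2 * σ y) * (2 * α * σ x) ≤ 1 / (2 * σ y) * (q₀ - 2 * l₂ y + b₂ y y) :=
    mul_le_mul_of_nonneg_left e₂ (by positivity)
  -- Only the dependence on σ remains. It is not concave, but in the ratio σ(x)/σ(y) the comparison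
  -- is exactly this inequality.
  have e₄ : Real.log (σ x / σ y) ≤ σ x / σ y - 1 := Real.log_le_sub_one_of_pos (by positivity)
  rw [Real.log_div hx.ne' hy.ne'] at e₄
  have e₅ := mul_le_mul_of_nonneg_left e₄ hα
  have e₆ : 1 / (2 * σ y) * (2 * α * σ x) = α * (σ x / σ y) := by field_simp
  have e₇ : 1 / (2 * σ x) * (2 * α * σ x) = α := by field_simp
  rw [hq, e₇]
  rw [e₆] at e₃
  linarith

end Calculus

/-! ### Closure properties of affine functions -/

section Affine

variable {V V' V'' : Type*} [AddCommGroup V] [Module ℝ V] [AddCommGroup V'] [Module ℝ V']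
  [AddCommGroup V''] [Module ℝ V'']

/-- The function agrees with an affine map. -/
def IsAffineFun (g : V → V') : Prop := ∃ L : V →ᵃ[ℝ] V', ∀ x, g x = L x

theorem IsAffineFun.const (c : V') : IsAffineFun fun _ : V => c :=
  ⟨AffineMap.const ℝ V c, fun _ => rfl⟩

theorem IsAffineFun.of_linear {g : V → V'} (h₁ : ∀ x y, g (x + y) = g x + g y)
    (h₂ : ∀ (c : ℝ) x, g (c • x) = c • g x) : IsAffineFun g :=
  ⟨LinearMap.toAffineMap { toFun := g, map_add' := h₁, map_smul' := h₂ }, fun _ => rfl⟩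

theorem IsAffineFun.add {g h : V → V'} (hg : IsAffineFun g) (hh : IsAffineFun h) :
    IsAffineFun fun x => g x + h x := by
  obtain ⟨L, hL⟩ := hg
  obtain ⟨L', hL'⟩ := hh
  exact ⟨L + L', fun x => by simp [hL, hL']⟩

theorem IsAffineFun.sub {g h : V → V'} (hg : IsAffineFun g) (hh : IsAffineFun h) :
    IsAffineFun fun x => g x - h x := by
  obtain ⟨L, hL⟩ := hg
  obtain ⟨L', hL'⟩ := hh
  exact ⟨L - L', fun x => by simp [hL, hL']⟩

theorem IsAffineFun.smul (c : ℝ) {g : V → V'} (hg : IsAffineFun g) :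
    IsAffineFun fun x => c • g x := by
  obtain ⟨L, hL⟩ := hg
  exact ⟨c • L, fun x => by simp [hL]⟩

theorem IsAffineFun.real_mul (c : ℝ) {g : V → ℝ} (hg : IsAffineFun g) :
    IsAffineFun fun x => c * g x := hg.smul c

theorem IsAffineFun.linear_comp {g : V → V'} (hg : IsAffineFun g) (ℓ : V' → V'')
    (h₁ : ∀ x y, ℓ (x + y) = ℓ x + ℓ y) (h₂ : ∀ (c : ℝ) x, ℓ (c • x) = c • ℓ x) :
    IsAffineFun fun x => ℓ (g x) := by
  obtain ⟨L, hL⟩ := hg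
  exact ⟨(LinearMap.toAffineMap { toFun := ℓ, map_add' := h₁, map_smul' := h₂ }).comp L,
    fun x => by simp [hL]⟩

theorem IsAffineFun.prod {g : V → V'} {h : V → V''} (hg : IsAffineFun g) (hh : IsAffineFun h) :
    IsAffineFun fun x => (g x, h x) := by
  obtain ⟨L, hL⟩ := hg
  obtain ⟨L', hL'⟩ := hh
  exact ⟨L.prod L', fun x => by simp [hL, hL']⟩

variable {a b c : Type*}

theorem IsAffineFun.mul_const [Fintype b] {g : V → Matrix a b ℝ} (hg : IsAffineFun g)
    (C : Matrix b c ℝ) : IsAffineFun fun x => g x * C :=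
  hg.linear_comp (· * C) (fun x y => Matrix.add_mul x y C) fun r x => Matrix.smul_mul r x C

theorem IsAffineFun.const_mul [Fintype b] {g : V → Matrix b c ℝ} (hg : IsAffineFun g)
    (C : Matrix a b ℝ) : IsAffineFun fun x => C * g x :=
  hg.linear_comp (C * ·) (fun x y => Matrix.mul_add C x y) fun r x => Matrix.mul_smul C r x

theorem IsAffineFun.transpose {g : V → Matrix a b ℝ} (hg : IsAffineFun g) :
    IsAffineFun fun x => (g x)ᵀ :=
  hg.linear_comp Matrix.transpose (fun _ _ => rfl) fun _ _ => rfl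

theorem IsAffineFun.trace [Fintype a] {g : V → Matrix a a ℝ} (hg : IsAffineFun g) :
    IsAffineFun fun x => (g x).trace :=
  hg.linear_comp Matrix.trace Matrix.trace_add Matrix.trace_smul

end Affine

/-! ### The conditional expected log-density as a quadratic function of the parameters -/

namespace Param

theorem W_add (S T : Param d k) : (S + T).W = S.W + T.W := rfl
theorem mu_add (S T : Param d k) : (S + T).mu = S.mu + T.mu := rfl
theorem deltaEps_add (S T : Param d k) : (S + T).deltaEps = S.deltaEps + T.deltaEps := rfl
theorem deltaX_add (S T : Param d k) : (S + T).deltaX = S.deltaX + T.deltaX := rfl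
theorem W_smul (c : ℝ) (S : Param d k) : (c • S).W = c • S.W := rfl
theorem mu_smul (c : ℝ) (S : Param d k) : (c • S).mu = c • S.mu := rfl
theorem deltaEps_smul (c : ℝ) (S : Param d k) : (c • S).deltaEps = c • S.deltaEps := rfl
theorem deltaX_smul (c : ℝ) (S : Param d k) : (c • S).deltaX = c • S.deltaX := rfl

end Param

/-- The matrix `M⁻¹ Wᵀ D_ε` of the regression of `X_t` on `Y_t` given the scale variables. -/
noncomputable def gain (D : Data d k N) (P : Param d k) (s : ℝ × ℝ) : Matrix (Fin k) (Fin d) ℝ :=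
  (M D P s)⁻¹ * P.Wᵀ * Deps D s

/-- The mean of `X_t` given `Y_t^o` and the scale variables. -/
noncomputable def latentMean (D : Data d k N) (P : Param d k) (t : Fin N) (s : ℝ × ℝ) :
    Matrix (Fin 1) (Fin k) ℝ :=
  EY D P t s * Deps D s * P.W * (M D P s)⁻¹ - bvec D P s * (M D P s)⁻¹

/-- `μ* + E[X_t] W*ᵀ + δ_ε* D_ε⁻¹` -/
noncomputable def fit (D : Data d k N) (P S : Param d k) (t : Fin N) (s : ℝ × ℝ) :
    Matrix (Fin 1) (Fin d) ℝ :=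
  S.mu + latentMean D P t s * S.Wᵀ + S.deltaEps * (Deps D s)⁻¹

/-- The conditional second moment of `μ* + X_t W*ᵀ + δ_ε* D_ε⁻¹` in the metric `D_ε`, in the form
of a bilinear form in the parameters. -/
noncomputable def fitForm (D : Data d k N) (P S S' : Param d k) (t : Fin N) (s : ℝ × ℝ) : ℝ :=
  (fit D P S t s * Deps D s * (fit D P S' t s)ᵀ).trace
    + (S.W * gain D P s * condCov D P t s * (S'.W * gain D P s)ᵀ * Deps D s).trace
    + P.sigma2 * (S.W * (M D P s)⁻¹ * S'.Wᵀ * Deps D s).trace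

/-- The conditional mixed moment of `Y_t` and `μ* + X_t W*ᵀ + δ_ε* D_ε⁻¹`. -/
noncomputable def fitLin (D : Data d k N) (P S : Param d k) (t : Fin N) (s : ℝ × ℝ) : ℝ :=
  (EY D P t s * Deps D s * (fit D P S t s)ᵀ).trace
    + (condCov D P t s * (S.W * gain D P s)ᵀ * Deps D s).trace

/-- The conditional second moment of `Y_t`. -/
noncomputable def fitConst (D : Data d k N) (P : Param d k) (t : Fin N) (s : ℝ × ℝ) : ℝ :=
  (EY D P t s * Deps D s * (EY D P t s)ᵀ).trace + (condCov D P t s * Deps D s).trace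

/-- The part of `v` that does not depend on `Ψ*`. -/
noncomputable def vBase (D : Data d k N) (P : Param d k) (t : Fin N) (s : ℝ × ℝ) : ℝ :=
  logScaleDensity D.nuEps s.1 + logScaleDensity D.nuX s.2
  - ((k : ℝ) + d) / 2 * Real.log (2 * Real.pi)
  + 1 / 2 * ∑ i, Real.log (scaleVec D.nuEps s.1 i)
  + 1 / 2 * ∑ j, Real.log (scaleVec D.nuX s.2 j)
  - 1 / 2 * ((M D P s)⁻¹ * P.Wᵀ * Deps D s * EYY D P t s * Deps D s * P.W * (M D P s)⁻¹ *
      Dx D s).trace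
  + ((M D P s)⁻¹ * P.Wᵀ * Deps D s * (EY D P t s)ᵀ * bvec D P s * (M D P s)⁻¹ * Dx D s).trace
  - 1 / 2 * ((M D P s)⁻¹ * (bvec D P s)ᵀ * bvec D P s * (M D P s)⁻¹ * Dx D s).trace
  - P.sigma2 / 2 * ((M D P s)⁻¹ * Dx D s).trace

variable {D : Data d k N} {P : Param d k} {s : ℝ × ℝ}

theorem transpose_Deps : (Deps D s)ᵀ = Deps D s := Matrix.diagonal_transpose _

theorem transpose_Deps_inv : ((Deps D s)⁻¹)ᵀ = (Deps D s)⁻¹ := by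
  rw [Matrix.transpose_nonsing_inv, transpose_Deps]

theorem transpose_M : (M D P s)ᵀ = M D P s := by
  unfold M
  simp only [Matrix.transpose_add, Matrix.transpose_smul, Matrix.transpose_mul,
    Matrix.transpose_transpose, transpose_Deps, Matrix.mul_assoc]
  rw [Dx, Matrix.diagonal_transpose]

theorem transpose_M_inv : ((M D P s)⁻¹)ᵀ = (M D P s)⁻¹ := by
  rw [Matrix.transpose_nonsing_inv, transpose_M]

theorem Deps_inv_mul (hnu : ∀ i, 0 < D.nuEps i) (hs : s ∈ openSquare) :
    (Deps D s)⁻¹ * Deps D s = 1 :=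
  Matrix.nonsing_inv_mul _ ((Matrix.isUnit_iff_isUnit_det _).1 (posDef_Deps hnu hs).isUnit)

theorem EYY_eq (t : Fin N) :
    EYY D P t s = condCov D P t s + (EY D P t s)ᵀ * EY D P t s := rfl

theorem bvec_eq : bvec D P s = P.mu * Deps D s * P.W + cvec P := by
  simp [bvec, cvec, add_sub_assoc]

theorem fit_add (S T : Param d k) (t : Fin N) :
    fit D P (S + T) t s = fit D P S t s + fit D P T t s := by
  simp only [fit, Param.W_add, Param.mu_add, Param.deltaEps_add, Matrix.transpose_add,
    Matrix.mul_add, Matrix.add_mul]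
  abel

theorem fit_smul (c : ℝ) (S : Param d k) (t : Fin N) :
    fit D P (c • S) t s = c • fit D P S t s := by
  simp only [fit, Param.W_smul, Param.mu_smul, Param.deltaEps_smul, Matrix.transpose_smul,
    Matrix.mul_smul, Matrix.smul_mul, smul_add]

theorem trace_scalar (x : ℝ) : (scalar x).trace = x := by
  simp [scalar, Matrix.trace]

theorem trace_form_symm {a n : Type*} [Fintype a] [Fintype n] {A : Matrix a a ℝ}
    {C : Matrix n n ℝ} (hA : Aᵀ = A) (hC : Cᵀ = C) (X Y : Matrix n a ℝ) :
    (X * A * Yᵀ * C).trace = (Y * A * Xᵀ * C).trace := by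
  rw [← Matrix.trace_transpose]
  have := Matrix.trace_mul_comm C (Y * A * Xᵀ)
  simpa only [Matrix.transpose_mul, Matrix.transpose_transpose, hA, hC, Matrix.mul_assoc]
    using this

theorem trace_form_nonneg {a n : Type*} [Fintype a] [Fintype n] [DecidableEq n]
    {A : Matrix a a ℝ} (hA : A.PosSemidef) {c : n → ℝ} (hc : ∀ i, 0 ≤ c i) (X : Matrix n a ℝ) :
    0 ≤ (X * A * Xᵀ * Matrix.diagonal c).trace := by
  have h := hA.mul_mul_conjTranspose_same X
  rw [Matrix.conjTranspose_eq_transpose_of_trivial] at h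
  simp only [Matrix.trace, Matrix.diag_apply, Matrix.mul_diagonal]
  exact Finset.sum_nonneg fun i _ => mul_nonneg h.diag_nonneg (hc i)

section Positive

variable (hnuEps : ∀ i, 0 < D.nuEps i) (hnuX : ∀ j, 0 < D.nuX j) (hP : 0 < P.sigma2)
  (hs : s ∈ openSquare)

include hnuEps hnuX hP hs

theorem transpose_condCov (t : Fin N) : (condCov D P t s)ᵀ = condCov D P t s := by
  have := (posSemidef_condCov hnuEps hnuX hP hs t).isHermitian
  rwa [Matrix.IsHermitian, Matrix.conjTranspose_eq_transpose_of_trivial] at this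

theorem fitForm_symm (S T : Param d k) (t : Fin N) :
    fitForm D P S T t s = fitForm D P T S t s := by
  unfold fitForm
  rw [trace_form_symm (transpose_condCov hnuEps hnuX hP hs t) transpose_Deps,
    trace_form_symm transpose_M_inv transpose_Deps]
  congr 2
  rw [← Matrix.trace_transpose]
  simp only [Matrix.transpose_mul, Matrix.transpose_transpose, transpose_Deps, Matrix.mul_assoc]

theorem fitForm_self_nonneg (S : Param d k) (t : Fin N) : 0 ≤ fitForm D P S S t s := by
  unfold fitForm
  have hpos : ∀ i, 0 ≤ scaleVec D.nuEps s.1 i := fun i => (scaleVec_pos hnuEps hs.1 i).le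
  have h1 := trace_form_nonneg (Matrix.PosSemidef.one (n := Fin 1) (R := ℝ)) hpos
    (fit D P S t s)ᵀ
  have h2 := trace_form_nonneg (posSemidef_condCov hnuEps hnuX hP hs t) hpos
    (S.W * gain D P s)
  have h3 := trace_form_nonneg (posDef_M_Nmat hnuEps hnuX hP hs).1.inv.posSemidef hpos S.W
  rw [Matrix.mul_one, Matrix.transpose_transpose, Matrix.mul_assoc, Matrix.trace_mul_comm] at h1
  exact add_nonneg (add_nonneg h1 h2) (mul_nonneg hP.le h3)

/-- The integrand of `d A₀` times the right-hand side of the equation for `σ*²`. -/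
theorem fitForm_eq_integrand (S : Param d k) (t : Fin N) :
    fitConst D P t s - 2 * fitLin D P S t s + fitForm D P S S t s =
      (a20 D P t s).trace + (S.mu * a1 D t s * S.muᵀ).trace
      + (S.deltaEps * a2 D t s * S.deltaEpsᵀ).trace
      + 2 * (a9 D P S.W t s * P.muᵀ).trace
      + 2 * ((a10 D P S.W t s - a6 D P t s - P.mu * a13 D P S.W t s) * S.muᵀ).trace
      - 2 * (a21 D P S.W t s).trace
      + P.sigma2 * ((a12 D P S.W t s)ᵀ * S.W).trace
      + ((a17 D P S.W t s)ᵀ * S.W).trace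
      - ((a18_1 D P S.W t s)ᵀ * S.W).trace
      - ((a18_2 D P S.W t s)ᵀ * S.W).trace
      + ((a19 D P S.W t s)ᵀ * S.W).trace
      + 2 * ((S.mu - a5 D P t s + a8 D P t s * S.Wᵀ - P.mu * a11 D P t s * S.Wᵀ) *
          S.deltaEpsᵀ).trace
      + 2 * ((a7 D P S.W t s - S.mu * a12 D P S.W t s - S.deltaEps * S.W * a4 D P t s) *
          (cvec P)ᵀ).trace ∧
    v D P S t s = vBase D P t s - (d : ℝ) / 2 * Real.log S.sigma2
      - 1 / 2 * (S.deltaX * (Dx D s)⁻¹ * S.deltaXᵀ).trace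
      + (latentMean D P t s * S.deltaXᵀ).trace
      - 1 / (2 * S.sigma2) *
        (fitConst D P t s - 2 * fitLin D P S t s + fitForm D P S S t s) := by
  have hD : (Deps D s)ᵀ = Deps D s := transpose_Deps
  have hR := transpose_condCov hnuEps hnuX hP hs t
  have hΓ : ((M D P s)⁻¹)ᵀ = (M D P s)⁻¹ := transpose_M_inv
  have hEEt : (EYY D P t s)ᵀ = EYY D P t s := by
    rw [EYY_eq]; simp [Matrix.transpose_mul, hR]
  have h1 := trace_EM_numerator hD (Deps_inv_mul hnuEps hs) transpose_Deps_inv hR hΓ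
    (EY D P t s) S.mu S.deltaEps (bvec D P s) S.W P.W P.sigma2 (EYY_eq t)
  have h2 := trace_EM_sigma2 (Di := (Deps D s)⁻¹) hD hEEt hΓ (EY D P t s) S.mu S.deltaEps P.mu
    (bvec D P s) (cvec P) S.W P.W P.sigma2 bvec_eq
  -- By symmetry of the covariances the three pieces recombine into the second moment of the
  -- residual, the left side of `trace_EM_numerator`.
  have h0 : fitConst D P t s - 2 * fitLin D P S t s + fitForm D P S S t s =
      ((EY D P t s - fit D P S t s) * Deps D s * (EY D P t s - fit D P S t s)ᵀ).trace
      + ((1 - S.W * gain D P s) * condCov D P t s * (1 - S.W * gain D P s)ᵀ * Deps D s).trace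
      + P.sigma2 * (S.W * (M D P s)⁻¹ * S.Wᵀ * Deps D s).trace := by
    have e1 : (fit D P S t s * Deps D s * (EY D P t s)ᵀ).trace =
        (EY D P t s * Deps D s * (fit D P S t s)ᵀ).trace := by
      rw [← Matrix.trace_transpose]
      simp only [Matrix.transpose_mul, Matrix.transpose_transpose, hD, Matrix.mul_assoc]
    have e2 := trace_form_symm hR hD (S.W * gain D P s) 1
    simp only [Matrix.transpose_one, Matrix.mul_one, Matrix.one_mul] at e2
    unfold fitConst fitLin fitForm
    simp only [Matrix.transpose_sub, Matrix.transpose_one, Matrix.mul_sub, Matrix.sub_mul,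
      Matrix.trace_sub, Matrix.one_mul, Matrix.mul_one, e1, e2]
    ring
  have h3 := h0.trans h1
  refine ⟨?_, ?_⟩
  · rw [a20, a21, trace_scalar, trace_scalar]
    exact h3.trans h2
  rw [h3]
  unfold v vBase latentMean
  simp only [Matrix.mul_add, Matrix.mul_sub, Matrix.sub_mul, Matrix.neg_mul, Matrix.mul_neg,
    Matrix.mul_smul, neg_smul, Matrix.transpose_neg, Matrix.trace_add, Matrix.trace_sub,
    Matrix.trace_neg, Matrix.trace_smul, smul_eq_mul, ← Matrix.mul_assoc]
  ring

end Positive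

/-- The integrand of `f`. -/
noncomputable def gradW (D : Data d k N) (P S : Param d k) (t : Fin N) (s : ℝ × ℝ) :
    Matrix (Fin d) (Fin k) ℝ :=
  a14 D P t s - a15 D P S.mu t s - S.deltaEpsᵀ * a8 D P t s - a16 D P S.mu t s
    + S.deltaEpsᵀ * P.mu * a11 D P t s + S.deltaEpsᵀ * cvec P * a4 D P t s
    - a17 D P S.W t s + a18_1 D P S.W t s + a18_2 D P S.W t s - a19 D P S.W t s
    - P.sigma2 • a12 D P S.W t s

/-- The integrand of the gradient in `μ*`. -/
noncomputable def gradMu (D : Data d k N) (P S : Param d k) (t : Fin N) (s : ℝ × ℝ) :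
    Matrix (Fin 1) (Fin d) ℝ :=
  a6 D P t s - a10 D P S.W t s - S.deltaEps + P.mu * a13 D P S.W t s
    + cvec P * (a12 D P S.W t s)ᵀ - S.mu * a1 D t s

/-- The integrand of the gradient in `δ_ε*`. -/
noncomputable def gradDelta (D : Data d k N) (P S : Param d k) (t : Fin N) (s : ℝ × ℝ) :
    Matrix (Fin 1) (Fin d) ℝ :=
  a5 D P t s - S.mu - a8 D P t s * S.Wᵀ + P.mu * a11 D P t s * S.Wᵀ
    + cvec P * a4 D P t s * S.Wᵀ - S.deltaEps * a2 D t s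

/-- Splitting `b` into its `μ D_ε W` part and `c`; this explains why the combination `A_8 - μ A_11 -
c A_4` recurs in the updates. -/
theorem latentMean_eq (t : Fin N) :
    latentMean D P t s = a8 D P t s - P.mu * a11 D P t s - cvec P * a4 D P t s := by
  simp only [latentMean, bvec_eq, a8, a11, a4, Matrix.add_mul, Matrix.mul_assoc, sub_sub]

/-- The mean residual is the score for δ_ε*: that direction enters the fit as `δ D_ε⁻¹`, which
cancels the metric. For μ* the weight `D_ε` stays. -/
theorem sub_fit_eq (S : Param d k) (t : Fin N) :
    EY D P t s - fit D P S t s = gradDelta D P S t s := by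
  rw [fit, gradDelta, latentMean_eq, a5, a2]
  simp only [Matrix.sub_mul]
  abel

theorem sub_fit_mul_Deps (hnu : ∀ i, 0 < D.nuEps i) (hs : s ∈ openSquare) (S : Param d k)
    (t : Fin N) : (EY D P t s - fit D P S t s) * Deps D s = gradMu D P S t s := by
  rw [fit, gradMu, latentMean_eq]
  simp only [Matrix.sub_mul, Matrix.add_mul, Matrix.mul_assoc, a6, a10, a13, a12, a1, a8, a11, a4,
    Deps_inv_mul hnu hs, Matrix.mul_one, Matrix.transpose_mul, transpose_Deps, transpose_M_inv]
  abel

/-- The derivative of the quadratic form in the parameters. -/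
theorem fitLin_sub_fitForm (hnuEps : ∀ i, 0 < D.nuEps i) (hnuX : ∀ j, 0 < D.nuX j)
    (hP : 0 < P.sigma2) (hs : s ∈ openSquare) (S T : Param d k) (t : Fin N) :
    fitLin D P T t s - fitForm D P S T t s =
      (gradMu D P S t s * T.muᵀ).trace + (gradDelta D P S t s * T.deltaEpsᵀ).trace
        + (gradW D P S t s * T.Wᵀ).trace := by
  have hD : (Deps D s)ᵀ = Deps D s := transpose_Deps
  have hR := transpose_condCov hnuEps hnuX hP hs t
  have hΓ : ((M D P s)⁻¹)ᵀ = (M D P s)⁻¹ := transpose_M_inv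
  -- The score for W* is `D_ε` times the expected product of residual and `X_t`: the product of the
  -- means, the covariance inherited from the missing entries through `gain`, and the variance of
  -- `X_t` given `Y_t`.
  have hW : gradW D P S t s = (gradMu D P S t s)ᵀ * latentMean D P t s
      + Deps D s * (1 - S.W * gain D P s) * condCov D P t s * (gain D P s)ᵀ
      - P.sigma2 • (Deps D s * S.W * (M D P s)⁻¹) := by
    have hg : gradMu D P S t s = EY D P t s * Deps D s - S.mu * Deps D s - S.deltaEps
        - (EY D P t s * Deps D s * P.W * (M D P s)⁻¹ - bvec D P s * (M D P s)⁻¹)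
          * S.Wᵀ * Deps D s := by
      rw [← sub_fit_mul_Deps hnuEps hs]
      simp only [fit, latentMean, Matrix.sub_mul, Matrix.add_mul, Matrix.mul_assoc,
        Deps_inv_mul hnuEps hs, Matrix.mul_one]
      abel
    rw [hg]
    unfold gradW latentMean gain a14 a15 a8 a16 a11 a4 a17 a18_1 a18_2 a19 a12
    have hb : S.deltaEpsᵀ * P.mu * (Deps D s * P.W * (M D P s)⁻¹)
        + S.deltaEpsᵀ * cvec P * (M D P s)⁻¹ = S.deltaEpsᵀ * bvec D P s * (M D P s)⁻¹ := by
      rw [bvec_eq]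
      simp only [Matrix.mul_add, Matrix.add_mul, Matrix.mul_assoc]
    rw [add_assoc (_ - _) (S.deltaEpsᵀ * P.mu * _), hb, EYY_eq]
    simp only [Matrix.transpose_sub, Matrix.transpose_mul,
      Matrix.transpose_transpose, hD, hΓ, Matrix.mul_add, Matrix.mul_sub, Matrix.add_mul,
      Matrix.sub_mul, Matrix.mul_one, Matrix.mul_assoc]
    abel
  have e1 : fitLin D P T t s - fitForm D P S T t s =
      ((EY D P t s - fit D P S t s) * Deps D s * (fit D P T t s)ᵀ).trace
      + ((1 - S.W * gain D P s) * condCov D P t s * (T.W * gain D P s)ᵀ * Deps D s).trace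
      - P.sigma2 * (S.W * (M D P s)⁻¹ * T.Wᵀ * Deps D s).trace := by
    unfold fitLin fitForm
    simp only [Matrix.sub_mul, Matrix.trace_sub, Matrix.one_mul]
    ring
  have e2 : (EY D P t s - fit D P S t s) * Deps D s * (Deps D s)⁻¹ = gradDelta D P S t s := by
    rw [Matrix.mul_assoc, Matrix.mul_nonsing_inv _
      ((Matrix.isUnit_iff_isUnit_det _).1 (posDef_Deps hnuEps hs).isUnit), Matrix.mul_one,
      sub_fit_eq]
  rw [e1, hW, ← e2, sub_fit_mul_Deps hnuEps hs, fit]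
  have e3 : ((1 - S.W * gain D P s) * condCov D P t s * (T.W * gain D P s)ᵀ * Deps D s).trace =
      (Deps D s * (1 - S.W * gain D P s) * condCov D P t s * (gain D P s)ᵀ * T.Wᵀ).trace := by
    rw [Matrix.trace_mul_comm]
    simp only [Matrix.transpose_mul, Matrix.mul_assoc]
  have e4 : (S.W * (M D P s)⁻¹ * T.Wᵀ * Deps D s).trace =
      (Deps D s * S.W * (M D P s)⁻¹ * T.Wᵀ).trace := by
    rw [Matrix.trace_mul_comm]
    simp only [Matrix.mul_assoc]
  have e5 : (gradMu D P S t s * (T.W * (latentMean D P t s)ᵀ)).trace =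
      ((gradMu D P S t s)ᵀ * latentMean D P t s * T.Wᵀ).trace := by
    rw [← Matrix.trace_transpose]
    have := Matrix.trace_mul_comm (latentMean D P t s * T.Wᵀ) (gradMu D P S t s)ᵀ
    simpa only [Matrix.transpose_mul, Matrix.transpose_transpose, Matrix.mul_assoc] using this
  rw [e3, e4]
  simp only [Matrix.transpose_add, Matrix.transpose_mul, Matrix.transpose_transpose,
    Matrix.mul_add, Matrix.add_mul _ _ (T.Wᵀ), Matrix.sub_mul _ _ (T.Wᵀ), Matrix.smul_mul,
    Matrix.trace_add, Matrix.trace_sub, Matrix.trace_smul, smul_eq_mul, transpose_Deps_inv,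
    ← Matrix.mul_assoc]
  rw [Matrix.mul_assoc (gradMu D P S t s) T.W, e5]
  ring

section Linearity

theorem fitForm_add_left (S S' T : Param d k) (t : Fin N) :
    fitForm D P (S + S') T t s = fitForm D P S T t s + fitForm D P S' T t s := by
  simp only [fitForm, fit_add, Param.W_add, Matrix.add_mul, Matrix.trace_add]
  ring

theorem fitForm_smul_left (c : ℝ) (S T : Param d k) (t : Fin N) :
    fitForm D P (c • S) T t s = c * fitForm D P S T t s := by
  simp only [fitForm, fit_smul, Param.W_smul, Matrix.smul_mul, Matrix.trace_smul, smul_eq_mul]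
  ring

theorem fitForm_add_right (S T T' : Param d k) (t : Fin N) :
    fitForm D P S (T + T') t s = fitForm D P S T t s + fitForm D P S T' t s := by
  simp only [fitForm, fit_add, Param.W_add, Matrix.add_mul, Matrix.mul_add, Matrix.transpose_add,
    Matrix.trace_add]
  ring

theorem fitForm_smul_right (c : ℝ) (S T : Param d k) (t : Fin N) :
    fitForm D P S (c • T) t s = c * fitForm D P S T t s := by
  simp only [fitForm, fit_smul, Param.W_smul, Matrix.smul_mul, Matrix.mul_smul,
    Matrix.transpose_smul, Matrix.trace_smul, smul_eq_mul]
  ring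

theorem fitLin_add (S T : Param d k) (t : Fin N) :
    fitLin D P (S + T) t s = fitLin D P S t s + fitLin D P T t s := by
  simp only [fitLin, fit_add, Param.W_add, Matrix.add_mul, Matrix.mul_add, Matrix.transpose_add,
    Matrix.trace_add]
  ring

theorem fitLin_smul (c : ℝ) (S : Param d k) (t : Fin N) :
    fitLin D P (c • S) t s = c * fitLin D P S t s := by
  simp only [fitLin, fit_smul, Param.W_smul, Matrix.smul_mul, Matrix.mul_smul,
    Matrix.transpose_smul, Matrix.trace_smul, smul_eq_mul]
  ring

end Linearity

/-! ### Positivity of the weighted integrals -/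

section Positivity

variable (hnuEps : ∀ i, 0 < D.nuEps i) (hnuX : ∀ j, 0 < D.nuX j) (hP : 0 < P.sigma2)
  (hconv : IntegralsConverge D P)

include hnuEps hnuX hP hconv

theorem likelihood_pos : 0 < likelihood D P :=
  Finset.prod_pos fun t _ => setIntegral_unitSquare_pos (hconv.density t) ∅ measure_empty
    (fun _ hs => (densO_pos hnuEps hnuX hP hs t).le)
    fun _ hs _ => densO_pos hnuEps hnuX hP hs t

theorem I2_pos (t : Fin N) : 0 < I2 D P t := by
  have h : IntegrableOn (m D P t) unitSquare := by
    have := hconv.c0 t 0 0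
    simpa [a0, scalar] using this
  exact setIntegral_unitSquare_pos h ∅ measure_empty
    (fun _ hs => (m_pos hnuEps hnuX hP hs t).le) fun _ hs _ => m_pos hnuEps hnuX hP hs t

theorem H_pos (t : Fin N) : 0 < H D P t :=
  Finset.prod_pos fun r _ => I2_pos hnuEps hnuX hP hconv r

theorem weighted_nonneg {F : Fin N → ℝ × ℝ → ℝ} (h : ∀ t, ∀ s ∈ openSquare, 0 ≤ F t s) :
    0 ≤ ∑ t, H D P t * ∫ s in unitSquare, F t s * m D P t s :=
  Finset.sum_nonneg fun t _ => mul_nonneg (H_pos hnuEps hnuX hP hconv t).le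
    (setIntegral_unitSquare_nonneg fun s hs => mul_nonneg (h t s hs)
      (m_pos hnuEps hnuX hP hs t).le)

theorem weighted_pos (hN : 0 < N) {F : Fin N → ℝ × ℝ → ℝ}
    (hF : ∀ t, IntegrableOn (fun s => F t s * m D P t s) unitSquare) (Z : Set (ℝ × ℝ))
    (hZ : volume Z = 0) (h0 : ∀ t, ∀ s ∈ openSquare, 0 ≤ F t s)
    (h : ∀ t, ∀ s ∈ openSquare, s ∉ Z → 0 < F t s) :
    0 < ∑ t, H D P t * ∫ s in unitSquare, F t s * m D P t s := by
  have : Nonempty (Fin N) := ⟨⟨0, hN⟩⟩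
  exact Finset.sum_pos (fun t _ => mul_pos (H_pos hnuEps hnuX hP hconv t)
    (setIntegral_unitSquare_pos (hF t) Z hZ
      (fun s hs => mul_nonneg (h0 t s hs) (m_pos hnuEps hnuX hP hs t).le)
      fun s hs hsZ => mul_pos (h t s hs hsZ) (m_pos hnuEps hnuX hP hs t)))
    Finset.univ_nonempty

end Positivity

/-- By injectivity the level set lies on a single line with fixed first coordinate. -/
theorem volume_level_eq_zero {n : ℕ} {ν : Fin n → ℝ} (hν : ∀ i, 0 < ν i) (i : Fin n) (c : ℝ) :
    volume {s : ℝ × ℝ | s ∈ openSquare ∧ scaleVec ν s.1 i = c} = 0 := by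
  rcases Set.eq_empty_or_nonempty {s : ℝ × ℝ | s ∈ openSquare ∧ scaleVec ν s.1 i = c} with h | h
  · rw [h, measure_empty]
  · obtain ⟨z, hz⟩ := h
    refine measure_mono_null (t := {z.1} ×ˢ Set.univ) (fun s hs => ?_) ?_
    · exact ⟨scaleVec_injOn hν i hs.1.1 hz.1.1 (hs.2.trans hz.2.symm), trivial⟩
    · rw [Measure.volume_eq_prod, Measure.prod_prod, measure_singleton, zero_mul]

theorem Deps_inv_eq (hnu : ∀ i, 0 < D.nuEps i) {s : ℝ × ℝ} (hs : s ∈ openSquare) :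
    (Deps D s)⁻¹ = Matrix.diagonal fun i => (scaleVec D.nuEps s.1 i)⁻¹ := by
  refine Matrix.inv_eq_left_inv ?_
  rw [Deps, Matrix.diagonal_mul_diagonal, ← Matrix.diagonal_one]
  exact congrArg _ (funext fun i => inv_mul_cancel₀ (scaleVec_pos hnu hs.1 i).ne')

theorem Dx_inv_eq (hnu : ∀ i, 0 < D.nuX i) {s : ℝ × ℝ} (hs : s ∈ openSquare) :
    (Dx D s)⁻¹ = Matrix.diagonal fun i => (scaleVec D.nuX s.2 i)⁻¹ := by
  refine Matrix.inv_eq_left_inv ?_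
  rw [Dx, Matrix.diagonal_mul_diagonal, ← Matrix.diagonal_one]
  exact congrArg _ (funext fun i => inv_mul_cancel₀ (scaleVec_pos hnu hs.2 i).ne')

/-- `Λ` computes the convergent integrals `∑_t H_t ∫∫ F_t m_t`. -/
def Extends (D : Data d k N) (P : Param d k) (Λ : (Fin N × openSquare → ℝ) →ₗ[ℝ] ℝ) : Prop :=
  ∀ F : Fin N → ℝ × ℝ → ℝ, (∀ t, IntegrableOn (fun s => F t s * m D P t s) unitSquare) →
    Λ (fun x => F x.1 x.2) = ∑ t, H D P t * ∫ s in unitSquare, F t s * m D P t s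

/-! ### The matrices `A_0, …, A_3` and strict Cauchy-Schwarz -/

section Functional

variable {Λ : (Fin N × openSquare → ℝ) →ₗ[ℝ] ℝ} (hΛ : Extends D P Λ)

include hΛ

theorem Extends.mapEntries_eq {ι κ : Type} {F : Fin N → ℝ × ℝ → Matrix ι κ ℝ}
    (hF : Converges D P F) : mapEntries Λ (fun x => F x.1 x.2) = intA D P F := by
  ext i j
  exact hΛ (fun t s => F t s i j) fun t => hF t i j

variable (hconv : IntegralsConverge D P)

include hconv

theorem Extends.map_one : Λ (fun _ => 1) = A0 D P := by
  rw [A0, ← hΛ.mapEntries_eq hconv.c0, ← map_trace]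
  simp only [a0, trace_scalar]

/-- Only the convergence of the whole integrand `v` is used; from here on it may be split freely,
since Λ is linear on all functions. -/
theorem Extends.Q_eq {S : Param d k} (hS : 0 < S.sigma2) :
    Q D P S = 1 / likelihood D P * Λ (fun x => v D P S x.1 x.2) := by
  rw [hΛ _ fun t => hconv.estep S t hS, Q]
  congr 1
  exact Finset.sum_congr rfl fun t _ => mul_comm _ _

variable (hN : 0 < N) (hnuEps : ∀ i, 0 < D.nuEps i) (hnuX : ∀ j, 0 < D.nuX j)
  (hP : 0 < P.sigma2)

include hnuEps hnuX hP hN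

theorem Extends.A0_pos : 0 < A0 D P := by
  rw [← hΛ.map_one hconv]
  rw [hΛ (fun _ _ => 1) fun t => hconv.c0 t 0 0]
  exact weighted_pos hnuEps hnuX hP hconv hN (fun t => hconv.c0 t 0 0) ∅ measure_empty
    (fun _ _ _ => zero_le_one) fun _ _ _ _ => zero_lt_one

omit hN hnuEps hnuX hP in
-- Diagonality reduces invertibility to positive diagonal entries.
theorem Extends.A1_eq : A1 D P = Matrix.diagonal fun i => A1 D P i i := by
  ext i j
  by_cases h : i = j
  · subst h; simp
  · rw [Matrix.diagonal_apply_ne _ h, A1, ← hΛ.mapEntries_eq hconv.c1, mapEntries_apply]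
    have : (fun x : Fin N × openSquare => a1 D x.1 x.2 i j) = 0 := by
      ext x; exact Matrix.diagonal_apply_ne _ h
    rw [this, map_zero]

omit hN hnuX hP in
theorem Extends.A2_eq : A2 D P = Matrix.diagonal fun i => A2 D P i i := by
  ext i j
  by_cases h : i = j
  · subst h; simp
  · rw [Matrix.diagonal_apply_ne _ h, A2, ← hΛ.mapEntries_eq hconv.c2, mapEntries_apply]
    have : (fun x : Fin N × openSquare => a2 D x.1 x.2 i j) = 0 := by
      ext x; rw [a2, Deps_inv_eq hnuEps x.2.2]; exact Matrix.diagonal_apply_ne _ h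
    rw [this, map_zero]

omit hN hnuEps hP in
theorem Extends.A3_eq : A3 D P = Matrix.diagonal fun i => A3 D P i i := by
  ext i j
  by_cases h : i = j
  · subst h; simp
  · rw [Matrix.diagonal_apply_ne _ h, A3, ← hΛ.mapEntries_eq hconv.c3, mapEntries_apply]
    have : (fun x : Fin N × openSquare => a3 D x.1 x.2 i j) = 0 := by
      ext x; rw [a3, Dx_inv_eq hnuX x.2.2]; exact Matrix.diagonal_apply_ne _ h
    rw [this, map_zero]

omit hΛ in
theorem A1_pos (i : Fin d) : 0 < A1 D P i i := by
  have h : ∀ (t : Fin N), ∀ s ∈ openSquare, 0 < a1 D t s i i := fun t s hs => by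
    rw [a1, Deps, Matrix.diagonal_apply_eq]; exact scaleVec_pos hnuEps hs.1 i
  exact weighted_pos hnuEps hnuX hP hconv hN (fun t => hconv.c1 t i i) ∅ measure_empty
    (fun t s hs => (h t s hs).le) fun t s hs _ => h t s hs

omit hΛ in
theorem A2_pos (i : Fin d) : 0 < A2 D P i i := by
  have h : ∀ (t : Fin N), ∀ s ∈ openSquare, 0 < a2 D t s i i := fun t s hs => by
    rw [a2, Deps_inv_eq hnuEps hs, Matrix.diagonal_apply_eq]
    exact inv_pos.2 (scaleVec_pos hnuEps hs.1 i)
  exact weighted_pos hnuEps hnuX hP hconv hN (fun t => hconv.c2 t i i) ∅ measure_empty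
    (fun t s hs => (h t s hs).le) fun t s hs _ => h t s hs

omit hΛ in
theorem A3_pos (i : Fin k) : 0 < A3 D P i i := by
  have h : ∀ (t : Fin N), ∀ s ∈ openSquare, 0 < a3 D t s i i := fun t s hs => by
    rw [a3, Dx_inv_eq hnuX hs, Matrix.diagonal_apply_eq]
    exact inv_pos.2 (scaleVec_pos hnuX hs.2 i)
  exact weighted_pos hnuEps hnuX hP hconv hN (fun t => hconv.c3 t i i) ∅ measure_empty
    (fun t s hs => (h t s hs).le) fun t s hs _ => h t s hs

/-- The strict Cauchy-Schwarz inequality for `D_ε^{1/2}` and `D_ε^{-1/2}`. -/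
theorem Extends.A0_sq_lt (i : Fin d) : A0 D P ^ 2 < A1 D P i i * A2 D P i i := by
  have h2 := A2_pos hconv hN hnuEps hnuX hP i
  -- The minimiser in `l` of `A_1 + 2 l A_0 + l² A_2` at the entry `(i, i)`, which is the integral
  -- of (x + l)²/x with `x` the `i`-th scale factor.
  set l := -(A0 D P / A2 D P i i) with hl
  let F : Fin N → ℝ × ℝ → ℝ := fun t s => a1 D t s i i + 2 * l * a0 t s 0 0 + l ^ 2 * a2 D t s i i
  have hF : ∀ t, IntegrableOn (fun s => F t s * m D P t s) unitSquare := fun t => by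
    have := ((hconv.c1 t i i).add ((hconv.c0 t 0 0).const_mul (2 * l))).add
      ((hconv.c2 t i i).const_mul (l ^ 2))
    refine this.congr (Filter.Eventually.of_forall fun s => ?_)
    simp only [F, Pi.add_apply]
    ring
  have hval : ∀ (t : Fin N), ∀ s ∈ openSquare, F t s =
      (scaleVec D.nuEps s.1 i + l) ^ 2 * (scaleVec D.nuEps s.1 i)⁻¹ := fun t s hs => by
    have := (scaleVec_pos hnuEps hs.1 i).ne'
    simp only [F, a1, a0, a2, scalar, Matrix.of_apply, Deps_inv_eq hnuEps hs]
    rw [Deps, Matrix.diagonal_apply_eq, Matrix.diagonal_apply_eq]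
    field_simp
    ring
  -- Strictness: the integrand vanishes only where the scale factor equals `-l`, a null set.
  have hpos := weighted_pos hnuEps hnuX hP hconv hN hF _ (volume_level_eq_zero hnuEps i (-l))
    (fun t s hs => by
      rw [hval t s hs]
      have := scaleVec_pos hnuEps hs.1 i
      positivity)
    (fun t s hs hsZ => by
      rw [hval t s hs]
      have h0 := scaleVec_pos hnuEps hs.1 i
      have h1 : scaleVec D.nuEps s.1 i + l ≠ 0 := fun h => hsZ ⟨hs, by linarith⟩
      positivity)
  rw [← hΛ F hF] at hpos
  have hsum : (fun x : Fin N × openSquare => F x.1 x.2) =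
      (fun x => a1 D x.1 x.2 i i) + (2 * l) • (fun _ => (1 : ℝ)) +
        (l ^ 2) • (fun x => a2 D x.1 x.2 i i) := by
    ext x; simp [F, a0, scalar]
  have e1 : Λ (fun x => a1 D x.1 x.2 i i) = A1 D P i i :=
    congrFun (congrFun (hΛ.mapEntries_eq hconv.c1) i) i
  have e2 : Λ (fun x => a2 D x.1 x.2 i i) = A2 D P i i :=
    congrFun (congrFun (hΛ.mapEntries_eq hconv.c2) i) i
  rw [hsum, map_add, map_add, map_smul, map_smul, hΛ.map_one hconv, e1, e2, hl] at hpos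
  simp only [smul_eq_mul] at hpos
  have e3 : A1 D P i i + 2 * -(A0 D P / A2 D P i i) * A0 D P +
      (-(A0 D P / A2 D P i i)) ^ 2 * A2 D P i i =
      (A1 D P i i * A2 D P i i - A0 D P ^ 2) / A2 D P i i := by
    field_simp; ring
  rw [e3] at hpos
  have := (div_pos_iff_of_pos_right h2).1 hpos
  linarith

end Functional

/-- `σ*²` as a linear form. -/
def sigma2Lin (d k : ℕ) : Param d k →ₗ[ℝ] ℝ where
  toFun S := S.sigma2
  map_add' _ _ := rfl
  map_smul' _ _ := rfl

/-- The quadratic form `δ_x* A δ_x*ᵀ`. -/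
noncomputable def deltaXForm (A : Matrix (Fin k) (Fin k) ℝ) :
    Param d k →ₗ[ℝ] Param d k →ₗ[ℝ] ℝ :=
  LinearMap.mk₂ ℝ (fun S T => (S.deltaX * A * T.deltaXᵀ).trace)
    (fun S S' T => by simp only [Param.deltaX_add, Matrix.add_mul, Matrix.trace_add])
    (fun c S T => by simp only [Param.deltaX_smul, Matrix.smul_mul, Matrix.trace_smul])
    (fun S T T' => by
      simp only [Param.deltaX_add, Matrix.transpose_add, Matrix.mul_add, Matrix.trace_add])
    (fun c S T => by
      simp only [Param.deltaX_smul, Matrix.transpose_smul, Matrix.mul_smul, Matrix.trace_smul])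

/-- The linear form `e δ_x*ᵀ`. -/
noncomputable def deltaXLin (d : ℕ) (e : Matrix (Fin 1) (Fin k) ℝ) : Param d k →ₗ[ℝ] ℝ where
  toFun S := (e * S.deltaXᵀ).trace
  map_add' S T := by
    simp only [Param.deltaX_add, Matrix.transpose_add, Matrix.mul_add, Matrix.trace_add]
  map_smul' c S := by
    simp only [Param.deltaX_smul, Matrix.transpose_smul, Matrix.mul_smul, Matrix.trace_smul,
      RingHom.id_apply]

variable (D P) in
/-- The integrated form `fitForm`. -/
noncomputable def intForm (Λ : (Fin N × openSquare → ℝ) →ₗ[ℝ] ℝ) :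
    Param d k →ₗ[ℝ] Param d k →ₗ[ℝ] ℝ :=
  LinearMap.mk₂ ℝ (fun S T => Λ fun x => fitForm D P S T x.1 x.2)
    (fun S S' T => by simp only [fitForm_add_left, map_fun_add])
    (fun c S T => by simp only [fitForm_smul_left, map_fun_mul, smul_eq_mul])
    (fun S T T' => by simp only [fitForm_add_right, map_fun_add])
    (fun c S T => by simp only [fitForm_smul_right, map_fun_mul, smul_eq_mul])

variable (D P) in
/-- The integrated linear form `fitLin`. -/
noncomputable def intLin (Λ : (Fin N × openSquare → ℝ) →ₗ[ℝ] ℝ) : Param d k →ₗ[ℝ] ℝ where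
  toFun S := Λ fun x => fitLin D P S x.1 x.2
  map_add' S T := by simp only [fitLin_add, map_fun_add]
  map_smul' c S := by simp only [fitLin_smul, map_fun_mul, smul_eq_mul, RingHom.id_apply]

theorem intForm_apply (Λ : (Fin N × openSquare → ℝ) →ₗ[ℝ] ℝ) (S T : Param d k) :
    intForm D P Λ S T = Λ fun x => fitForm D P S T x.1 x.2 := rfl

theorem intLin_apply (Λ : (Fin N × openSquare → ℝ) →ₗ[ℝ] ℝ) (S : Param d k) :
    intLin D P Λ S = Λ fun x => fitLin D P S x.1 x.2 := rfl

/-- `σ*² π(y)` times the gradient of `Q` in `μ*`. -/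
noncomputable def intGradMu (D : Data d k N) (P S : Param d k) : Matrix (Fin 1) (Fin d) ℝ :=
  A6 D P - A10 D P S.W - A0 D P • S.deltaEps + P.mu * A13 D P S.W + cvec P * (A12 D P S.W)ᵀ
    - S.mu * A1 D P

/-- `σ*² π(y)` times the gradient of `Q` in `δ_ε*`. -/
noncomputable def intGradDelta (D : Data d k N) (P S : Param d k) : Matrix (Fin 1) (Fin d) ℝ :=
  A5 D P - A0 D P • S.mu - A8 D P * S.Wᵀ + P.mu * A11 D P * S.Wᵀ + cvec P * A4 D P * S.Wᵀ
    - S.deltaEps * A2 D P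

/-- The integrated mean of `X_t`. -/
noncomputable def intLatentMean (D : Data d k N) (P : Param d k) : Matrix (Fin 1) (Fin k) ℝ :=
  A8 D P - P.mu * A11 D P - cvec P * A4 D P

/-! ### Integrated scores and the expansion of `Q` -/

section Functional

variable {Λ : (Fin N × openSquare → ℝ) →ₗ[ℝ] ℝ} (hΛ : Extends D P Λ)
  (hconv : IntegralsConverge D P)

include hΛ hconv

theorem Extends.map_gradMu (S : Param d k) :
    mapEntries Λ (fun x => gradMu D P S x.1 x.2) = intGradMu D P S := by
  simp only [gradMu, intGradMu, mapEntries_add, mapEntries_sub, mapEntries_mul_left,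
    mapEntries_transpose, mapEntries_const, hΛ.map_one hconv, hΛ.mapEntries_eq hconv.c6,
    hΛ.mapEntries_eq (hconv.c10 _), hΛ.mapEntries_eq (hconv.c13 _),
    hΛ.mapEntries_eq (hconv.c12 _), hΛ.mapEntries_eq hconv.c1]
  rfl

theorem Extends.map_gradDelta (S : Param d k) :
    mapEntries Λ (fun x => gradDelta D P S x.1 x.2) = intGradDelta D P S := by
  simp only [gradDelta, intGradDelta, mapEntries_add, mapEntries_sub, mapEntries_mul_left,
    mapEntries_mul_right, mapEntries_const, hΛ.map_one hconv, hΛ.mapEntries_eq hconv.c5,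
    hΛ.mapEntries_eq hconv.c8, hΛ.mapEntries_eq hconv.c11,
    hΛ.mapEntries_eq hconv.c4, hΛ.mapEntries_eq hconv.c2]
  rfl

theorem Extends.map_gradW (S : Param d k) :
    mapEntries Λ (fun x => gradW D P S x.1 x.2) = f D P S := by
  simp only [gradW, f, mapEntries_add, mapEntries_sub, mapEntries_mul_left, mapEntries_smul,
    hΛ.mapEntries_eq hconv.c14, hΛ.mapEntries_eq (hconv.c15 _), hΛ.mapEntries_eq hconv.c8,
    hΛ.mapEntries_eq (hconv.c16 _), hΛ.mapEntries_eq hconv.c11, hΛ.mapEntries_eq hconv.c4,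
    hΛ.mapEntries_eq (hconv.c17 _), hΛ.mapEntries_eq (hconv.c18_1 _),
    hΛ.mapEntries_eq (hconv.c18_2 _), hΛ.mapEntries_eq (hconv.c19 _),
    hΛ.mapEntries_eq (hconv.c12 _)]
  rfl

theorem Extends.map_latentMean :
    mapEntries Λ (fun x => latentMean D P x.1 x.2) = intLatentMean D P := by
  simp only [latentMean_eq, intLatentMean, mapEntries_sub, mapEntries_mul_left,
    hΛ.mapEntries_eq hconv.c8, hΛ.mapEntries_eq hconv.c11, hΛ.mapEntries_eq hconv.c4]
  rfl

variable (hnuEps : ∀ i, 0 < D.nuEps i) (hnuX : ∀ j, 0 < D.nuX j) (hP : 0 < P.sigma2)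

include hnuEps hnuX hP

omit hΛ hconv in
theorem intForm_symm (S T : Param d k) : intForm D P Λ S T = intForm D P Λ T S := by
  rw [intForm_apply, intForm_apply]
  congr 1
  funext x
  exact fitForm_symm hnuEps hnuX hP x.2.2 S T x.1

theorem Extends.intLin_sub_intForm (S T : Param d k) :
    intLin D P Λ T - intForm D P Λ S T = (intGradMu D P S * T.muᵀ).trace
      + (intGradDelta D P S * T.deltaEpsᵀ).trace + (f D P S * T.Wᵀ).trace := by
  rw [← hΛ.map_gradMu hconv, ← hΛ.map_gradDelta hconv, ← hΛ.map_gradW hconv,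
    ← mapEntries_mul_right, ← mapEntries_mul_right, ← mapEntries_mul_right,
    ← map_trace, ← map_trace, ← map_trace, ← map_fun_add, ← map_fun_add, intLin_apply,
    intForm_apply, ← map_fun_sub]
  congr 1
  funext x
  exact fitLin_sub_fitForm hnuEps hnuX hP x.2.2 S T x.1

/-- Brings the integral of `v` into the shape of `hasFDerivAt_logGaussian`, with `α = d A_0 / 2`. -/
theorem Extends.map_v (S : Param d k) :
    Λ (fun x => v D P S x.1 x.2) = Λ (fun x => vBase D P x.1 x.2)
      - (d : ℝ) / 2 * A0 D P * Real.log S.sigma2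
      - 1 / 2 * deltaXForm (A3 D P) S S + deltaXLin d (intLatentMean D P) S
      - 1 / (2 * S.sigma2) *
        (Λ (fun x => fitConst D P x.1 x.2) - 2 * intLin D P Λ S + intForm D P Λ S S) := by
  have h : (fun x : Fin N × openSquare => v D P S x.1 x.2) = fun x =>
      vBase D P x.1 x.2 - (d : ℝ) / 2 * Real.log S.sigma2 * 1
      - 1 / 2 * (S.deltaX * a3 D x.1 x.2 * S.deltaXᵀ).trace
      + (latentMean D P x.1 x.2 * S.deltaXᵀ).trace
      - 1 / (2 * S.sigma2) *
        (fitConst D P x.1 x.2 - 2 * fitLin D P S x.1 x.2 + fitForm D P S S x.1 x.2) := by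
    funext x
    rw [mul_one]
    exact (fitForm_eq_integrand hnuEps hnuX hP x.2.2 S x.1).2
  rw [h, map_fun_sub, map_fun_add, map_fun_sub, map_fun_sub, map_fun_mul, map_fun_mul, map_fun_mul,
    map_fun_add, map_fun_sub, map_fun_mul, map_trace, map_trace, mapEntries_mul_right,
    mapEntries_mul_right, mapEntries_mul_left, hΛ.map_one hconv, hΛ.mapEntries_eq hconv.c3,
    hΛ.map_latentMean hconv, ← intLin_apply, ← intForm_apply]
  have e1 : (S.deltaX * intA D P (a3 D) * S.deltaXᵀ).trace = deltaXForm (A3 D P) S S := rfl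
  have e2 : (intLatentMean D P * S.deltaXᵀ).trace = deltaXLin d (intLatentMean D P) S := rfl
  rw [e1, e2]
  ring

/-- Convergence of the integral of `fitForm` is not among the hypotheses. At σ*² = 1 and δ_x* = 0,
however, `fitForm` on the diagonal is the second difference 2v(0) - v(T) - v(-T), whose terms do
converge, so Λ is a genuine integral there. -/
theorem Extends.intForm_self_nonneg (T : Param d k) : 0 ≤ intForm D P Λ T T := by
  -- Resetting σ*² and δ_x* leaves `fit` unchanged and makes the hypothesis `estep` applicable for
  -- arbitrary `T`.
  let lift : Param d k → Param d k := fun S => (S.1, S.2.1, 1, S.2.2.2.1, 0)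
  let F : Fin N → ℝ × ℝ → ℝ := fun t s =>
    2 * v D P (lift 0) t s - v D P (lift T) t s - v D P (lift ((-1 : ℝ) • T)) t s
  have hF : ∀ t, IntegrableOn (fun s => F t s * m D P t s) unitSquare := fun t => by
    have := (((hconv.estep (lift 0) t zero_lt_one).const_mul 2).sub
      (hconv.estep (lift T) t zero_lt_one)).sub
      (hconv.estep (lift ((-1 : ℝ) • T)) t zero_lt_one)
    refine this.congr (Filter.Eventually.of_forall fun s => ?_)
    simp only [F, Pi.sub_apply]
    ring
  have hval : ∀ (t : Fin N), ∀ s ∈ openSquare, F t s = fitForm D P T T t s := fun t s hs => by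
    have hv : ∀ S, v D P (lift S) t s = vBase D P t s
        - 1 / 2 * (fitConst D P t s - 2 * fitLin D P S t s + fitForm D P S S t s) := fun S => by
      rw [(fitForm_eq_integrand hnuEps hnuX hP hs (lift S) t).2]
      have h1 : (lift S).sigma2 = 1 := rfl
      have h2 : (lift S).deltaX = 0 := rfl
      have h3 : fitLin D P (lift S) t s = fitLin D P S t s := rfl
      have h4 : fitForm D P (lift S) (lift S) t s = fitForm D P S S t s := rfl
      rw [h1, h2, h3, h4]
      simp
    have h0 : fitLin D P 0 t s = 0 := by
      have := fitLin_smul (D := D) (P := P) (s := s) 0 0 t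
      rwa [zero_smul, zero_mul] at this
    have h0' : fitForm D P 0 0 t s = 0 := by
      have := fitForm_smul_left (D := D) (P := P) (s := s) 0 0 0 t
      rwa [zero_smul, zero_mul] at this
    simp only [F, hv, h0, h0', fitLin_smul, fitForm_smul_left, fitForm_smul_right]
    ring
  have h : intForm D P Λ T T = Λ (fun x => F x.1 x.2) := by
    rw [intForm_apply]
    congr 1
    funext x
    exact (hval x.1 x.2 x.2.2).symm
  rw [h, hΛ F hF]
  exact weighted_nonneg hnuEps hnuX hP hconv fun t s hs => by
    rw [hval t s hs]; exact fitForm_self_nonneg hnuEps hnuX hP hs T t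

/-- Identifies the integrated squared residual with the bracket of the σ*² formula; the score in σ*²
thereby becomes proportional to update minus σ*². -/
theorem Extends.map_quadratic (hd : 0 < d) (hN : 0 < N) (S : Param d k) :
    Λ (fun x => fitConst D P x.1 x.2) - 2 * intLin D P Λ S + intForm D P Λ S S =
      d * A0 D P * sigma2Update D P S := by
  have hA0 := hΛ.A0_pos hconv hN hnuEps hnuX hP
  have hd' : (0 : ℝ) < d := Nat.cast_pos.2 hd
  have h : (fun x : Fin N × openSquare =>
      fitConst D P x.1 x.2 - 2 * fitLin D P S x.1 x.2 + fitForm D P S S x.1 x.2) = fun x =>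
      (a20 D P x.1 x.2).trace + (S.mu * a1 D x.1 x.2 * S.muᵀ).trace
      + (S.deltaEps * a2 D x.1 x.2 * S.deltaEpsᵀ).trace
      + 2 * (a9 D P S.W x.1 x.2 * P.muᵀ).trace
      + 2 * ((a10 D P S.W x.1 x.2 - a6 D P x.1 x.2
          - P.mu * a13 D P S.W x.1 x.2) * S.muᵀ).trace
      - 2 * (a21 D P S.W x.1 x.2).trace
      + P.sigma2 * ((a12 D P S.W x.1 x.2)ᵀ * S.W).trace
      + ((a17 D P S.W x.1 x.2)ᵀ * S.W).trace
      - ((a18_1 D P S.W x.1 x.2)ᵀ * S.W).trace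
      - ((a18_2 D P S.W x.1 x.2)ᵀ * S.W).trace
      + ((a19 D P S.W x.1 x.2)ᵀ * S.W).trace
      + 2 * ((S.mu - a5 D P x.1 x.2 + a8 D P x.1 x.2 * S.Wᵀ
          - P.mu * a11 D P x.1 x.2 * S.Wᵀ) * S.deltaEpsᵀ).trace
      + 2 * ((a7 D P S.W x.1 x.2 - S.mu * a12 D P S.W x.1 x.2
          - S.deltaEps * S.W * a4 D P x.1 x.2) * (cvec P)ᵀ).trace :=
    funext fun x => (fitForm_eq_integrand hnuEps hnuX hP x.2.2 S x.1).1
  rw [intLin_apply, intForm_apply, ← map_fun_mul, ← map_fun_sub, ← map_fun_add, h, sigma2Update,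
    sigma2Formula, ← mul_assoc, mul_one_div_cancel (by positivity), one_mul]
  simp only [map_fun_add, map_fun_sub, map_fun_mul, map_trace, mapEntries_mul_right,
    mapEntries_mul_left, mapEntries_transpose, mapEntries_add, mapEntries_sub, mapEntries_const,
    hΛ.map_one hconv,
    hΛ.mapEntries_eq hconv.c20, hΛ.mapEntries_eq hconv.c1, hΛ.mapEntries_eq hconv.c2,
    hΛ.mapEntries_eq (hconv.c9 _), hΛ.mapEntries_eq (hconv.c10 _), hΛ.mapEntries_eq hconv.c6,
    hΛ.mapEntries_eq (hconv.c13 _), hΛ.mapEntries_eq (hconv.c21 _),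
    hΛ.mapEntries_eq (hconv.c12 _), hΛ.mapEntries_eq (hconv.c17 _),
    hΛ.mapEntries_eq (hconv.c18_1 _), hΛ.mapEntries_eq (hconv.c18_2 _),
    hΛ.mapEntries_eq (hconv.c19 _), hΛ.mapEntries_eq hconv.c5, hΛ.mapEntries_eq hconv.c8,
    hΛ.mapEntries_eq hconv.c11, hΛ.mapEntries_eq (hconv.c7 _), hΛ.mapEntries_eq hconv.c4]
  rfl

end Functional

/-! ### Gradients tested against all directions -/

section Vanishing

variable {n l : ℕ}

theorem trace_mul_row_transpose (G : Matrix (Fin 1) (Fin n) ℝ) (h : Fin n → ℝ) :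
    (G * (row h)ᵀ).trace = ∑ i, G 0 i * h i := by
  simp [Matrix.trace, Matrix.mul_apply, row]

theorem trace_mul_row_eq_zero_iff (G : Matrix (Fin 1) (Fin n) ℝ) :
    (∀ h : Fin n → ℝ, (G * (row h)ᵀ).trace = 0) ↔ G = 0 := by
  constructor
  · intro h
    have h0 := h (G 0)
    rw [trace_mul_row_transpose, Finset.sum_eq_zero_iff_of_nonneg
      fun i _ => mul_self_nonneg _] at h0
    ext i j
    rw [Subsingleton.elim i 0]
    exact mul_self_eq_zero.1 (h0 j (Finset.mem_univ _))
  · rintro rfl h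
    simp

theorem trace_mul_transpose_eq_zero_iff (G : Matrix (Fin n) (Fin l) ℝ) :
    (∀ h : Matrix (Fin n) (Fin l) ℝ, (G * hᵀ).trace = 0) ↔ G = 0 := by
  constructor
  · intro h
    have h0 := h G
    rw [← Matrix.conjTranspose_eq_transpose_of_trivial,
      Matrix.trace_mul_conjTranspose_self_eq_zero_iff] at h0
    exact h0
  · rintro rfl h
    simp

theorem sub_mul_eq_zero_iff {A : Matrix (Fin n) (Fin n) ℝ} {a : Fin n → ℝ}
    (hA : A = Matrix.diagonal a) (ha : ∀ i, 0 < a i) (x U : Matrix (Fin 1) (Fin n) ℝ) :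
    U - x * A = 0 ↔ x = U * A⁻¹ := by
  have hu : IsUnit A.det := by
    rw [hA, Matrix.det_diagonal]
    exact (Finset.prod_pos fun i _ => ha i).ne'.isUnit
  rw [sub_eq_zero]
  constructor
  · intro h
    rw [h, Matrix.mul_nonsing_inv_cancel_right _ _ hu]
  · intro h
    rw [h, Matrix.nonsing_inv_mul_cancel_right _ _ hu]

end Vanishing

/-! ### Stationary points and maximizers -/

section Critical

variable {Λ : (Fin N × openSquare → ℝ) →ₗ[ℝ] ℝ} (hΛ : Extends D P Λ)
  (hconv : IntegralsConverge D P) (hnuEps : ∀ i, 0 < D.nuEps i) (hnuX : ∀ j, 0 < D.nuX j)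
  (hP : 0 < P.sigma2) (hN : 0 < N)

include hΛ hconv hnuEps hnuX hP hN

theorem Extends.muUpdate_iff (S : Param d k) : intGradMu D P S = 0 ↔ S.mu = muUpdate D P S :=
  sub_mul_eq_zero_iff (hΛ.A1_eq hconv) (A1_pos hconv hN hnuEps hnuX hP) _ _

theorem Extends.deltaEpsUpdate_iff (S : Param d k) :
    intGradDelta D P S = 0 ↔ S.deltaEps = deltaEpsUpdate D P S :=
  sub_mul_eq_zero_iff (hΛ.A2_eq hconv hnuEps) (A2_pos hconv hN hnuEps hnuX hP) _ _

theorem Extends.deltaXUpdate_iff (S : Param d k) :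
    intLatentMean D P - S.deltaX * A3 D P = 0 ↔ S.deltaX = deltaXUpdate D P :=
  sub_mul_eq_zero_iff (hΛ.A3_eq hconv hnuX) (A3_pos hconv hN hnuEps hnuX hP) _ _

omit hnuEps hP hN hΛ in
theorem deltaXForm_symm (hΛ : Extends D P Λ) (S T : Param d k) :
    deltaXForm (A3 D P) S T = deltaXForm (A3 D P) T S := by
  have hA : (A3 D P)ᵀ = A3 D P := by
    rw [hΛ.A3_eq hconv hnuX, Matrix.diagonal_transpose]
  change (S.deltaX * A3 D P * T.deltaXᵀ).trace = (T.deltaX * A3 D P * S.deltaXᵀ).trace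
  rw [← Matrix.trace_transpose]
  simp only [Matrix.transpose_mul, Matrix.transpose_transpose, hA, Matrix.mul_assoc]

theorem Extends.deltaXForm_self_nonneg (S : Param d k) : 0 ≤ deltaXForm (A3 D P) S S := by
  have h := trace_form_nonneg (Matrix.PosSemidef.one (n := Fin 1) (R := ℝ))
    (fun i => (A3_pos hconv hN hnuEps hnuX hP i).le) S.deltaXᵀ
  rw [← hΛ.A3_eq hconv hnuX, Matrix.mul_one, Matrix.transpose_transpose, Matrix.mul_assoc,
    Matrix.trace_mul_comm] at h
  exact h

omit hN hnuEps hP hnuX hΛ hconv in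
theorem deltaXLin_sub_deltaXForm (S T : Param d k) :
    deltaXLin d (intLatentMean D P) T - deltaXForm (A3 D P) S T =
      ((intLatentMean D P - S.deltaX * A3 D P) * T.deltaXᵀ).trace := by
  rw [Matrix.sub_mul, Matrix.trace_sub]; rfl

omit hN in
theorem Extends.Q_eq_logGaussian {S : Param d k} (hS : 0 < S.sigma2) :
    Q D P S = 1 / likelihood D P * (Λ (fun x => vBase D P x.1 x.2)
      - (d : ℝ) / 2 * A0 D P * Real.log (sigma2Lin d k S)
      - 1 / 2 * deltaXForm (A3 D P) S S + deltaXLin d (intLatentMean D P) S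
      - 1 / (2 * sigma2Lin d k S) *
        (Λ (fun x => fitConst D P x.1 x.2) - 2 * intLin D P Λ S + intForm D P Λ S S)) := by
  rw [hΛ.Q_eq hconv hS, hΛ.map_v hconv hnuEps hnuX hP]; rfl

omit hN hΛ hconv hnuEps hnuX hP in
theorem isOpen_sigma2_pos : IsOpen {S : Param d k | 0 < S.sigma2} :=
  isOpen_lt continuous_const (continuous_fst.comp (continuous_snd.comp continuous_snd))

/-- The derivative of `Q(Ψ, ·)`. -/
theorem Extends.hasFDerivAt_Q (hd : 0 < d) {S : Param d k} (hS : 0 < S.sigma2) :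
    ∃ F' : Param d k →L[ℝ] ℝ, HasFDerivAt (Q D P) F' S ∧ ∀ T, F' T =
      1 / likelihood D P * (((intLatentMean D P - S.deltaX * A3 D P) * T.deltaXᵀ).trace
        + 1 / S.sigma2 * ((intGradMu D P S * T.muᵀ).trace
          + (intGradDelta D P S * T.deltaEpsᵀ).trace + (f D P S * T.Wᵀ).trace)
        + d * A0 D P * (sigma2Update D P S - S.sigma2) / (2 * S.sigma2 ^ 2) * T.sigma2) := by
  obtain ⟨F', hF', hval⟩ := hasFDerivAt_logGaussian (sigma2Lin d k) (deltaXLin d (intLatentMean D P))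
    (intLin D P Λ) (deltaXForm (A3 D P)) (intForm D P Λ) (deltaXForm_symm hconv hnuX hΛ)
    (intForm_symm hnuEps hnuX hP) (Λ fun x => vBase D P x.1 x.2) ((d : ℝ) / 2 * A0 D P)
    (Λ fun x => fitConst D P x.1 x.2) (x := S) hS
  refine ⟨(1 / likelihood D P) • F', (hF'.const_mul (1 / likelihood D P)).congr_of_eventuallyEq ?_,
    fun T => ?_⟩
  -- The closed form of `Q` is available only where σ*² > 0; this set is open, which suffices for
  -- the derivative.
  · filter_upwards [isOpen_sigma2_pos.mem_nhds hS] with S' hS'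
    exact hΛ.Q_eq_logGaussian hconv hnuEps hnuX hP hS'
  · rw [_root_.smul_apply, hval, deltaXLin_sub_deltaXForm,
      hΛ.intLin_sub_intForm hconv hnuEps hnuX hP, hΛ.map_quadratic hconv hnuEps hnuX hP hd hN,
      smul_eq_mul]
    change 1 / likelihood D P * (_ + 1 / S.sigma2 * _ + (_ - 2 * _ * S.sigma2) /
      (2 * S.sigma2 ^ 2) * T.sigma2) = _
    congr 3
    ring

/-- The five equations are the hypotheses of `logGaussian_le`: the one for δ_x* makes `b₁` and `l₁`
agree, those for μ*, δ_ε*, W* do the same for `b₂` and `l₂`, and the one for σ*² fixes the value of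
the quadratic part. -/
theorem Extends.Q_le_of_solvesMStep (hd : 0 < d) {S T : Param d k} (hS : 0 < S.sigma2)
    (hT : 0 < T.sigma2) (h : SolvesMStep D P S) : Q D P T ≤ Q D P S := by
  obtain ⟨h1, h2, h3, h4, h5⟩ := h
  rw [← hΛ.muUpdate_iff hconv hnuEps hnuX hP hN] at h1
  rw [← hΛ.deltaEpsUpdate_iff hconv hnuEps hnuX hP hN] at h2
  rw [← hΛ.deltaXUpdate_iff hconv hnuEps hnuX hP hN] at h3
  rw [hΛ.Q_eq_logGaussian hconv hnuEps hnuX hP hT, hΛ.Q_eq_logGaussian hconv hnuEps hnuX hP hS]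
  have hA0 := hΛ.A0_pos hconv hN hnuEps hnuX hP
  have hL := likelihood_pos hnuEps hnuX hP hconv
  refine mul_le_mul_of_nonneg_left (logGaussian_le _ _ _ _ _ (deltaXForm_symm hconv hnuX hΛ)
    (intForm_symm hnuEps hnuX hP) (hΛ.deltaXForm_self_nonneg hconv hnuEps hnuX hP hN)
    (hΛ.intForm_self_nonneg hconv hnuEps hnuX hP) (by positivity) hS hT (fun H => ?_) (fun H => ?_)
    ?_) (by positivity)
  · have := deltaXLin_sub_deltaXForm (D := D) (P := P) S H
    rw [h3, Matrix.zero_mul, Matrix.trace_zero] at this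
    linarith
  · have := hΛ.intLin_sub_intForm hconv hnuEps hnuX hP S H
    rw [h1, h2, h5, Matrix.zero_mul, Matrix.zero_mul, Matrix.zero_mul, Matrix.trace_zero,
      Matrix.trace_zero] at this
    linarith
  · rw [hΛ.map_quadratic hconv hnuEps hnuX hP hd hN, ← h4]
    change _ = 2 * ((d : ℝ) / 2 * A0 D P) * S.sigma2
    ring

/-- The stationarity equations. -/
theorem Extends.stationary (hd : 0 < d) {S : Param d k} (hS : 0 < S.sigma2) :
    DifferentiableAt ℝ (Q D P) S ∧
      ((∀ h, fderiv ℝ (Q D P) S (0, h, 0, 0, 0) = 0) ↔ S.mu = muUpdate D P S) ∧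
      ((∀ h, fderiv ℝ (Q D P) S (0, 0, 0, h, 0) = 0) ↔ S.deltaEps = deltaEpsUpdate D P S) ∧
      ((∀ h, fderiv ℝ (Q D P) S (0, 0, 0, 0, h) = 0) ↔ S.deltaX = deltaXUpdate D P) ∧
      (fderiv ℝ (Q D P) S (0, 0, 1, 0, 0) = 0 ↔ S.sigma2 = sigma2Update D P S) ∧
      (0 < likelihood D P ∧ ∀ h, fderiv ℝ (Q D P) S (h, 0, 0, 0, 0) =
        (S.sigma2 * likelihood D P)⁻¹ * ∑ i, ∑ j, f D P S i j * h i j) ∧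
      (fderiv ℝ (Q D P) S = 0 ↔ SolvesMStep D P S) ∧
      (IsMaxOn (Q D P) {S' | 0 < S'.sigma2} S ↔ SolvesMStep D P S) := by
  obtain ⟨F', hF', hval⟩ := hΛ.hasFDerivAt_Q hconv hnuEps hnuX hP hN hd hS
  have hL := likelihood_pos hnuEps hnuX hP hconv
  have hA0 := hΛ.A0_pos hconv hN hnuEps hnuX hP
  have hd' : (0 : ℝ) < d := Nat.cast_pos.2 hd
  have row_zero : ∀ n : ℕ, row (0 : Fin n → ℝ) = 0 := fun _ => rfl
  have hL' : 1 / likelihood D P ≠ 0 := (one_div_pos.2 hL).ne'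
  have hS' : 1 / S.sigma2 ≠ 0 := (one_div_pos.2 hS).ne'
  have vW : ∀ h : Fin d → Fin k → ℝ, F' (h, 0, 0, 0, 0) =
      1 / likelihood D P * (1 / S.sigma2 * (f D P S * (Matrix.of h)ᵀ).trace) := fun h => by
    rw [hval]
    simp [Param.mu, Param.deltaEps, Param.deltaX, Param.sigma2, Param.W, row_zero]
  have vmu : ∀ h, F' (0, h, 0, 0, 0) =
      1 / likelihood D P * (1 / S.sigma2 * (intGradMu D P S * (row h)ᵀ).trace) := fun h => by
    rw [hval]
    simp [Param.mu, Param.deltaEps, Param.deltaX, Param.sigma2, Param.W, row_zero]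
  have vs : F' (0, 0, 1, 0, 0) = 1 / likelihood D P *
      (d * A0 D P * (sigma2Update D P S - S.sigma2) / (2 * S.sigma2 ^ 2)) := by
    rw [hval]
    simp [Param.mu, Param.deltaEps, Param.deltaX, Param.sigma2, Param.W, row_zero]
  have vde : ∀ h, F' (0, 0, 0, h, 0) =
      1 / likelihood D P * (1 / S.sigma2 * (intGradDelta D P S * (row h)ᵀ).trace) := fun h => by
    rw [hval]
    simp [Param.mu, Param.deltaEps, Param.deltaX, Param.sigma2, Param.W, row_zero]
  have vdx : ∀ h, F' (0, 0, 0, 0, h) = 1 / likelihood D P *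
      ((intLatentMean D P - S.deltaX * A3 D P) * (row h)ᵀ).trace := fun h => by
    rw [hval]
    simp [Param.mu, Param.deltaEps, Param.deltaX, Param.sigma2, Param.W, row_zero]
  have iW : (∀ h, F' (h, 0, 0, 0, 0) = 0) ↔ f D P S = 0 := by
    rw [← trace_mul_transpose_eq_zero_iff]
    exact forall_congr' fun h => by
      rw [vW h, mul_eq_zero_iff_left hL', mul_eq_zero_iff_left hS']; rfl
  have imu : (∀ h, F' (0, h, 0, 0, 0) = 0) ↔ S.mu = muUpdate D P S := by
    rw [← hΛ.muUpdate_iff hconv hnuEps hnuX hP hN, ← trace_mul_row_eq_zero_iff]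
    exact forall_congr' fun h => by
      rw [vmu h, mul_eq_zero_iff_left hL', mul_eq_zero_iff_left hS']
  have ide : (∀ h, F' (0, 0, 0, h, 0) = 0) ↔ S.deltaEps = deltaEpsUpdate D P S := by
    rw [← hΛ.deltaEpsUpdate_iff hconv hnuEps hnuX hP hN, ← trace_mul_row_eq_zero_iff]
    exact forall_congr' fun h => by
      rw [vde h, mul_eq_zero_iff_left hL', mul_eq_zero_iff_left hS']
  have idx : (∀ h, F' (0, 0, 0, 0, h) = 0) ↔ S.deltaX = deltaXUpdate D P := by
    rw [← hΛ.deltaXUpdate_iff hconv hnuEps hnuX hP hN, ← trace_mul_row_eq_zero_iff]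
    exact forall_congr' fun h => by rw [vdx h, mul_eq_zero_iff_left hL']
  have isig : F' (0, 0, 1, 0, 0) = 0 ↔ S.sigma2 = sigma2Update D P S := by
    rw [vs, mul_eq_zero_iff_left hL', div_eq_zero_iff, or_iff_left (by positivity),
      mul_eq_zero_iff_left (by positivity), sub_eq_zero, eq_comm]
  have iall : F' = 0 ↔ SolvesMStep D P S := by
    rw [SolvesMStep, ← imu, ← ide, ← idx, ← isig, ← iW]
    constructor
    · rintro rfl
      exact ⟨fun _ => rfl, fun _ => rfl, fun _ => rfl, rfl, fun _ => rfl⟩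
    · rintro ⟨h1, h2, h3, h4, h5⟩
      refine ContinuousLinearMap.ext fun T => ?_
      obtain ⟨w, a, c, b, e⟩ := T
      have hT : ((w, a, c, b, e) : Param d k) = (w, 0, 0, 0, 0) + (0, a, 0, 0, 0)
          + c • (0, 0, 1, 0, 0) + (0, 0, 0, b, 0) + (0, 0, 0, 0, e) := by
        simp
      rw [hT, map_add, map_add, map_add, map_add, map_smul, h1, h2, h3, h4, h5]
      simp
  rw [hF'.fderiv]
  refine ⟨hF'.differentiableAt, imu, ide, idx, isig, ⟨hL, fun h => ?_⟩, iall, fun hmax => ?_,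
    fun h T hT => hΛ.Q_le_of_solvesMStep hconv hnuEps hnuX hP hN hd hS hT h⟩
  · rw [vW, mul_inv, ← mul_assoc, one_div, one_div, mul_comm (likelihood D P)⁻¹]
    rfl
  · rw [← iall, ← hF'.fderiv]
    -- The domain is open, so a maximum over it is a local maximum and Fermat's rule applies.
    exact (hmax.isLocalMax (isOpen_sigma2_pos.mem_nhds hS)).fderiv_eq_zero

end Critical

/-! ### Affine dependence of the updates on the parameters -/

theorem isAffineFun_mapEntries {V X : Type*} [AddCommGroup V] [Module ℝ V]
    (Λ : (X → ℝ) →ₗ[ℝ] ℝ) {ι κ : Type*} (g : V → X → Matrix ι κ ℝ)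
    (h₁ : ∀ v w x, g (v + w) x = g v x + g w x) (h₂ : ∀ (c : ℝ) v x, g (c • v) x = c • g v x) :
    IsAffineFun fun v => mapEntries Λ (g v) :=
  IsAffineFun.of_linear
    (fun v w => by
      rw [← mapEntries_add]
      exact congrArg _ (funext fun x => h₁ v w x))
    (fun c v => by
      rw [← mapEntries_smul]
      exact congrArg _ (funext fun x => h₂ c v x))

section Functional

variable {Λ : (Fin N × openSquare → ℝ) →ₗ[ℝ] ℝ} (hΛ : Extends D P Λ)
  (hconv : IntegralsConverge D P)

include hΛ

theorem Extends.isAffineFun_intA {V : Type*} [AddCommGroup V] [Module ℝ V] {ι κ : Type}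
    (g : V → Fin N → ℝ × ℝ → Matrix ι κ ℝ) (hg : ∀ v, Converges D P (g v))
    (h₁ : ∀ v w t s, g (v + w) t s = g v t s + g w t s)
    (h₂ : ∀ (c : ℝ) v t s, g (c • v) t s = c • g v t s) :
    IsAffineFun fun v => intA D P (g v) := by
  simp only [← fun v => hΛ.mapEntries_eq (hg v)]
  exact isAffineFun_mapEntries Λ (fun v x => g v x.1 x.2) (fun v w x => h₁ v w x.1 x.2)
    fun c v x => h₂ c v x.1 x.2

include hconv

theorem Extends.isAffineFun_A7 : IsAffineFun (A7 D P) :=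
  hΛ.isAffineFun_intA _ hconv.c7 (fun _ _ _ _ => by simp only [a7, Matrix.mul_add, Matrix.add_mul])
    fun _ _ _ _ => by simp only [a7, Matrix.mul_smul, Matrix.smul_mul]

theorem Extends.isAffineFun_A9 : IsAffineFun (A9 D P) :=
  hΛ.isAffineFun_intA _ hconv.c9 (fun _ _ _ _ => by simp only [a9, Matrix.mul_add, Matrix.add_mul])
    fun _ _ _ _ => by simp only [a9, Matrix.mul_smul, Matrix.smul_mul]

theorem Extends.isAffineFun_A10 : IsAffineFun (A10 D P) :=
  hΛ.isAffineFun_intA _ hconv.c10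
    (fun _ _ _ _ => by simp only [a10, Matrix.mul_add, Matrix.add_mul, Matrix.transpose_add])
    fun _ _ _ _ => by simp only [a10, Matrix.mul_smul, Matrix.smul_mul, Matrix.transpose_smul]

theorem Extends.isAffineFun_A12 : IsAffineFun (A12 D P) :=
  hΛ.isAffineFun_intA _ hconv.c12
    (fun _ _ _ _ => by simp only [a12, Matrix.mul_add, Matrix.add_mul])
    fun _ _ _ _ => by simp only [a12, Matrix.mul_smul, Matrix.smul_mul]

theorem Extends.isAffineFun_A13 : IsAffineFun (A13 D P) :=
  hΛ.isAffineFun_intA _ hconv.c13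
    (fun _ _ _ _ => by simp only [a13, Matrix.mul_add, Matrix.add_mul, Matrix.transpose_add])
    fun _ _ _ _ => by simp only [a13, Matrix.mul_smul, Matrix.smul_mul, Matrix.transpose_smul]

theorem Extends.isAffineFun_A15 : IsAffineFun (A15 D P) :=
  hΛ.isAffineFun_intA _ hconv.c15
    (fun _ _ _ _ => by simp only [a15, Matrix.mul_add, Matrix.add_mul, Matrix.transpose_add])
    fun _ _ _ _ => by simp only [a15, Matrix.mul_smul, Matrix.smul_mul, Matrix.transpose_smul]

/-- Unlike the other integrals this one is affine without being linear in its argument. The value at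
μ* = 0 is split off, and the remainder needs no separate convergence statement because Λ is defined
on it anyway. -/
theorem Extends.isAffineFun_A16 : IsAffineFun (A16 D P) := by
  have h : A16 D P = fun mu' => mapEntries Λ (fun x => a16 D P 0 x.1 x.2) - mapEntries Λ
      (fun x => Deps D x.2 * mu'ᵀ * bvec D P x.2 * (M D P x.2)⁻¹) := by
    funext mu'
    rw [A16, ← hΛ.mapEntries_eq (hconv.c16 _), ← mapEntries_sub]
    congr 1
    funext x
    simp only [a16, sub_zero, Matrix.transpose_sub, Matrix.mul_sub, Matrix.sub_mul]
  rw [h]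
  exact (IsAffineFun.const _).sub (isAffineFun_mapEntries Λ _
    (fun _ _ _ => by simp only [Matrix.mul_add, Matrix.add_mul, Matrix.transpose_add])
    fun _ _ _ => by simp only [Matrix.mul_smul, Matrix.smul_mul, Matrix.transpose_smul])

theorem Extends.isAffineFun_A17 : IsAffineFun (A17 D P) :=
  hΛ.isAffineFun_intA _ hconv.c17
    (fun _ _ _ _ => by simp only [a17, Matrix.mul_add, Matrix.add_mul])
    fun _ _ _ _ => by simp only [a17, Matrix.mul_smul, Matrix.smul_mul]

theorem Extends.isAffineFun_A18_1 : IsAffineFun (A18_1 D P) :=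
  hΛ.isAffineFun_intA _ hconv.c18_1
    (fun _ _ _ _ => by simp only [a18_1, Matrix.mul_add, Matrix.add_mul])
    fun _ _ _ _ => by simp only [a18_1, Matrix.mul_smul, Matrix.smul_mul]

theorem Extends.isAffineFun_A18_2 : IsAffineFun (A18_2 D P) :=
  hΛ.isAffineFun_intA _ hconv.c18_2
    (fun _ _ _ _ => by simp only [a18_2, Matrix.mul_add, Matrix.add_mul])
    fun _ _ _ _ => by simp only [a18_2, Matrix.mul_smul, Matrix.smul_mul]

theorem Extends.isAffineFun_A19 : IsAffineFun (A19 D P) :=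
  hΛ.isAffineFun_intA _ hconv.c19
    (fun _ _ _ _ => by simp only [a19, Matrix.mul_add, Matrix.add_mul])
    fun _ _ _ _ => by simp only [a19, Matrix.mul_smul, Matrix.smul_mul]

theorem Extends.isAffineFun_A21 : IsAffineFun (A21 D P) := by
  have h₁ : ∀ x y : ℝ, scalar (x + y) = scalar x + scalar y := fun _ _ => rfl
  have h₂ : ∀ c x : ℝ, scalar (c * x) = c • scalar x := fun _ _ => rfl
  exact (hΛ.isAffineFun_intA _ hconv.c21
    (fun _ _ _ _ => by
      simp only [a21, Matrix.mul_add, Matrix.add_mul, Matrix.transpose_add, Matrix.trace_add, h₁])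
    fun _ _ _ _ => by
      simp only [a21, Matrix.mul_smul, Matrix.smul_mul, Matrix.transpose_smul, Matrix.trace_smul,
        smul_eq_mul, h₂]).trace

/-- The part of the equation for `μ*` that depends on `W*`. -/
theorem Extends.isAffineFun_muRhs : IsAffineFun fun w =>
    A6 D P - A10 D P w + P.mu * A13 D P w + cvec P * (A12 D P w)ᵀ :=
  (((IsAffineFun.const _).sub (hΛ.isAffineFun_A10 hconv)).add
    ((hΛ.isAffineFun_A13 hconv).const_mul _)).add
    ((hΛ.isAffineFun_A12 hconv).transpose.const_mul _)

omit hΛ hconv in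
theorem isAffineFun_transpose {a b : Type*} :
    IsAffineFun fun w : Matrix a b ℝ => wᵀ :=
  IsAffineFun.of_linear (fun _ _ => rfl) fun _ _ => rfl

omit hΛ hconv in
/-- The part of the equation for `δ_ε*` that depends on `W*`. -/
theorem isAffineFun_deltaEpsRhs : IsAffineFun fun w : Matrix (Fin d) (Fin k) ℝ =>
    A5 D P - A8 D P * wᵀ + P.mu * A11 D P * wᵀ + cvec P * A4 D P * wᵀ :=
  (((IsAffineFun.const _).sub (isAffineFun_transpose.const_mul _)).add
    (isAffineFun_transpose.const_mul _)).add (isAffineFun_transpose.const_mul _)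

theorem Extends.isAffineFun_muUpdate (S : Param d k) :
    IsAffineFun fun w : Matrix (Fin d) (Fin k) ℝ => muUpdate D P (w, S.2) := by
  have h10 := hΛ.isAffineFun_A10 hconv
  have h12 := hΛ.isAffineFun_A12 hconv
  have h13 := hΛ.isAffineFun_A13 hconv
  change IsAffineFun fun w : Matrix (Fin d) (Fin k) ℝ =>
    (A6 D P - A10 D P w - A0 D P • S.deltaEps + P.mu * A13 D P w + cvec P * (A12 D P w)ᵀ) *
    (A1 D P)⁻¹
  repeat' with_reducible first
    | exact IsAffineFun.const _
    | exact h10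
    | exact h12
    | exact h13
    | refine IsAffineFun.mul_const ?_ _
    | refine IsAffineFun.const_mul ?_ _
    | refine IsAffineFun.sub ?_ ?_
    | refine IsAffineFun.add ?_ ?_
    | refine IsAffineFun.trace ?_
    | refine IsAffineFun.transpose ?_

omit hΛ hconv in
theorem isAffineFun_deltaEpsUpdate (S : Param d k) :
    IsAffineFun fun w : Matrix (Fin d) (Fin k) ℝ => deltaEpsUpdate D P (w, S.2) := by
  have ht := isAffineFun_transpose (a := Fin d) (b := Fin k)
  change IsAffineFun fun w : Matrix (Fin d) (Fin k) ℝ =>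
    (A5 D P - A0 D P • S.mu - A8 D P * wᵀ + P.mu * A11 D P * wᵀ + cvec P * A4 D P * wᵀ) *
    (A2 D P)⁻¹
  repeat' with_reducible first
    | exact IsAffineFun.const _
    | exact ht
    | refine IsAffineFun.mul_const ?_ _
    | refine IsAffineFun.const_mul ?_ _
    | refine IsAffineFun.sub ?_ ?_
    | refine IsAffineFun.add ?_ ?_

omit hΛ hconv in
-- Terms such as the trace of `A_17ᵀ W*` are bilinear in the inner and the outer W*, so affinity is
-- claimed only for one of them at a time.
theorem isAffineFun_sigma2Formula_outside (w : Matrix (Fin d) (Fin k) ℝ) (S : Param d k) :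
    IsAffineFun fun W : Matrix (Fin d) (Fin k) ℝ => sigma2Formula D P w (W, S.2) := by
  have hid : IsAffineFun fun W : Matrix (Fin d) (Fin k) ℝ => W :=
    IsAffineFun.of_linear (fun _ _ => rfl) fun _ _ => rfl
  have ht := isAffineFun_transpose (a := Fin d) (b := Fin k)
  change IsAffineFun fun W : Matrix (Fin d) (Fin k) ℝ =>
    1 / (d * A0 D P) *
    (A20 D P + (S.mu * A1 D P * S.muᵀ).trace + (S.deltaEps * A2 D P * S.deltaEpsᵀ).trace
      + 2 * (A9 D P w * P.muᵀ).trace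
      + 2 * ((A10 D P w - A6 D P - P.mu * A13 D P w) * S.muᵀ).trace
      - 2 * A21 D P w
      + P.sigma2 * ((A12 D P w)ᵀ * W).trace
      + ((A17 D P w)ᵀ * W).trace
      - ((A18_1 D P w)ᵀ * W).trace
      - ((A18_2 D P w)ᵀ * W).trace
      + ((A19 D P w)ᵀ * W).trace
      + 2 * ((A0 D P • S.mu - A5 D P + A8 D P * Wᵀ - P.mu * A11 D P * Wᵀ) *
          S.deltaEpsᵀ).trace
      + 2 * ((A7 D P w - S.mu * A12 D P w - S.deltaEps * W * A4 D P) * (cvec P)ᵀ).trace)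
  repeat' with_reducible first
    | exact IsAffineFun.const _
    | exact hid
    | exact ht
    | refine IsAffineFun.mul_const ?_ _
    | refine IsAffineFun.const_mul ?_ _
    | refine IsAffineFun.sub ?_ ?_
    | refine IsAffineFun.add ?_ ?_
    | refine IsAffineFun.trace ?_
    | refine IsAffineFun.transpose ?_
    | refine IsAffineFun.real_mul _ ?_

theorem Extends.isAffineFun_sigma2Formula_inside (S : Param d k) :
    IsAffineFun fun w => sigma2Formula D P w S := by
  have h7 := hΛ.isAffineFun_A7 hconv
  have h9 := hΛ.isAffineFun_A9 hconv
  have h10 := hΛ.isAffineFun_A10 hconv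
  have h12 := hΛ.isAffineFun_A12 hconv
  have h13 := hΛ.isAffineFun_A13 hconv
  have h17 := hΛ.isAffineFun_A17 hconv
  have h18 := hΛ.isAffineFun_A18_1 hconv
  have h18' := hΛ.isAffineFun_A18_2 hconv
  have h19 := hΛ.isAffineFun_A19 hconv
  have h21 := hΛ.isAffineFun_A21 hconv
  unfold sigma2Formula
  repeat' with_reducible first
    | exact IsAffineFun.const _
    | exact h7
    | exact h9
    | exact h10
    | exact h12
    | exact h13
    | exact h17
    | exact h18
    | exact h18'
    | exact h19
    | exact h21
    | refine IsAffineFun.mul_const ?_ _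
    | refine IsAffineFun.const_mul ?_ _
    | refine IsAffineFun.sub ?_ ?_
    | refine IsAffineFun.add ?_ ?_
    | refine IsAffineFun.trace ?_
    | refine IsAffineFun.transpose ?_
    | refine IsAffineFun.real_mul _ ?_

omit hΛ hconv in
theorem IsAffineFun.comp_row_fst {n n' : ℕ} {V : Type*} [AddCommGroup V] [Module ℝ V]
    {g : Matrix (Fin 1) (Fin n) ℝ → V} (hg : IsAffineFun g) :
    IsAffineFun fun x : (Fin n → ℝ) × (Fin n' → ℝ) => g (row x.1) := by
  obtain ⟨L, hL⟩ := hg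
  let r : (Fin n → ℝ) × (Fin n' → ℝ) →ₗ[ℝ] Matrix (Fin 1) (Fin n) ℝ :=
    { toFun := fun x => row x.1, map_add' := fun _ _ => rfl, map_smul' := fun _ _ => rfl }
  exact ⟨L.comp r.toAffineMap, fun x => hL _⟩

theorem Extends.isAffineFun_f (S : Param d k) :
    IsAffineFun fun x : (Fin d → ℝ) × (Fin d → ℝ) =>
      f D P (S.1, x.1, S.2.2.1, x.2, S.2.2.2.2) := by
  have hδ : IsAffineFun fun x : (Fin d → ℝ) × (Fin d → ℝ) => (row x.2)ᵀ :=
    IsAffineFun.of_linear (fun _ _ => rfl) fun _ _ => rfl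
  have h15 := (hΛ.isAffineFun_A15 hconv).comp_row_fst (n' := d)
  have h16 := (hΛ.isAffineFun_A16 hconv).comp_row_fst (n' := d)
  change IsAffineFun fun x : (Fin d → ℝ) × (Fin d → ℝ) =>
    A14 D P - A15 D P (row x.1) - (row x.2)ᵀ * A8 D P - A16 D P (row x.1)
    + (row x.2)ᵀ * P.mu * A11 D P + (row x.2)ᵀ * cvec P * A4 D P
    - A17 D P S.W + A18_1 D P S.W + A18_2 D P S.W - A19 D P S.W - P.sigma2 • A12 D P S.W
  repeat' with_reducible first
    | exact IsAffineFun.const _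
    | exact hδ
    | exact h15
    | exact h16
    | refine IsAffineFun.mul_const ?_ _
    | refine IsAffineFun.sub ?_ ?_
    | refine IsAffineFun.add ?_ ?_

/-- The joint solution of the equations for `μ*` and `δ_ε*`. -/
theorem Extends.exists_joint_solution (hN : 0 < N) (hnuEps : ∀ i, 0 < D.nuEps i)
    (hnuX : ∀ j, 0 < D.nuX j) (hP : 0 < P.sigma2) :
    ∃ L : Matrix (Fin d) (Fin k) ℝ →ᵃ[ℝ] Matrix (Fin 1) (Fin d) ℝ × Matrix (Fin 1) (Fin d) ℝ,
      ∀ S : Param d k, (S.mu = muUpdate D P S ∧ S.deltaEps = deltaEpsUpdate D P S) ↔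
        (S.mu, S.deltaEps) = L S.W := by
  -- Since `A_1`, `A_2` are diagonal, coordinate `i` of the two equations is a 2 × 2 system with
  -- diagonal entries those of `A_1`, `A_2` and off-diagonal entry `A_0`. `Δ` holds the inverse
  -- determinants for Cramer's rule.
  set Δ : Matrix (Fin d) (Fin d) ℝ :=
    Matrix.diagonal fun i => (A1 D P i i * A2 D P i i - A0 D P ^ 2)⁻¹ with hΔ
  have hU := hΛ.isAffineFun_muRhs hconv
  have hT := isAffineFun_deltaEpsRhs (D := D) (P := P)
  obtain ⟨L, hL⟩ := (((hU.mul_const (A2 D P)).sub (hT.smul (A0 D P))).mul_const Δ).prod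
    (((hT.mul_const (A1 D P)).sub (hU.smul (A0 D P))).mul_const Δ)
  refine ⟨L, fun S => ?_⟩
  rw [← hL, Prod.mk.injEq, ← hΛ.muUpdate_iff hconv hnuEps hnuX hP hN,
    ← hΛ.deltaEpsUpdate_iff hconv hnuEps hnuX hP hN]
  set U := A6 D P - A10 D P S.W + P.mu * A13 D P S.W + cvec P * (A12 D P S.W)ᵀ with hUdef
  set T := A5 D P - A8 D P * S.Wᵀ + P.mu * A11 D P * S.Wᵀ + cvec P * A4 D P * S.Wᵀ with hTdef
  have e1 : intGradMu D P S = U - A0 D P • S.deltaEps - S.mu * A1 D P := by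
    rw [intGradMu, hUdef]; abel
  have e2 : intGradDelta D P S = T - A0 D P • S.mu - S.deltaEps * A2 D P := by
    rw [intGradDelta, hTdef]; abel
  rw [e1, e2, hΛ.A1_eq hconv, hΛ.A2_eq hconv hnuEps, hΔ]
  have key : ∀ i, ((U 0 i - A0 D P * S.deltaEps 0 i - S.mu 0 i * A1 D P i i = 0 ∧
      T 0 i - A0 D P * S.mu 0 i - S.deltaEps 0 i * A2 D P i i = 0) ↔
      (S.mu 0 i = (U 0 i * A2 D P i i - A0 D P * T 0 i) *
          (A1 D P i i * A2 D P i i - A0 D P ^ 2)⁻¹ ∧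
        S.deltaEps 0 i = (T 0 i * A1 D P i i - A0 D P * U 0 i) *
          (A1 D P i i * A2 D P i i - A0 D P ^ 2)⁻¹)) := fun i => by
    have hdet : A1 D P i i * A2 D P i i - A0 D P ^ 2 ≠ 0 :=
      (sub_pos.2 (hΛ.A0_sq_lt hconv hN hnuEps hnuX hP i)).ne'
    rw [← div_eq_mul_inv, ← div_eq_mul_inv, eq_div_iff hdet, eq_div_iff hdet]
    constructor
    · rintro ⟨h1, h2⟩
      constructor
      · linear_combination (-A2 D P i i) * h1 + A0 D P * h2
      · linear_combination (-A1 D P i i) * h2 + A0 D P * h1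
    · rintro ⟨h1, h2⟩
      constructor
      -- Substituting Cramer's formulas yields the equation multiplied by the determinant, which is
      -- then cancelled.
      · refine (mul_eq_zero_iff_left hdet).1 ?_
        linear_combination (-A1 D P i i) * h1 - A0 D P * h2
      · refine (mul_eq_zero_iff_left hdet).1 ?_
        linear_combination (-A2 D P i i) * h2 - A0 D P * h1
  have hext : ∀ X Y : Matrix (Fin 1) (Fin d) ℝ, X = Y ↔ ∀ i, X 0 i = Y 0 i := fun X Y =>
    ⟨fun h i => by rw [h], fun h => by
      ext a i
      rw [Subsingleton.elim a 0, h i]⟩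
  simp only [hext, Matrix.sub_apply, Matrix.smul_apply, smul_eq_mul, Matrix.mul_diagonal,
    Matrix.zero_apply, ← forall_and, key]

end Functional

end GStPPCA

theorem theorem2 {d k N : ℕ} (hd : 0 < d) (hN : 0 < N) (D : Data d k N)
    (hnuEps : ∀ i, 0 < D.nuEps i) (hnuX : ∀ j, 0 < D.nuX j)
    (P : Param d k) (hP : 0 < P.sigma2) (hconv : IntegralsConverge D P) :
    -- the stationarity equations, one group of variables at a time and together
    (∀ S : Param d k, 0 < S.sigma2 →
      DifferentiableAt ℝ (Q D P) S ∧
      ((∀ h, fderiv ℝ (Q D P) S (0, h, 0, 0, 0) = 0) ↔ S.mu = muUpdate D P S) ∧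
      ((∀ h, fderiv ℝ (Q D P) S (0, 0, 0, h, 0) = 0) ↔ S.deltaEps = deltaEpsUpdate D P S) ∧
      ((∀ h, fderiv ℝ (Q D P) S (0, 0, 0, 0, h) = 0) ↔ S.deltaX = deltaXUpdate D P) ∧
      (fderiv ℝ (Q D P) S (0, 0, 1, 0, 0) = 0 ↔ S.sigma2 = sigma2Update D P S) ∧
      (0 < likelihood D P ∧ ∀ h, fderiv ℝ (Q D P) S (h, 0, 0, 0, 0) =
        (S.sigma2 * likelihood D P)⁻¹ * ∑ i, ∑ j, f D P S i j * h i j) ∧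
      (fderiv ℝ (Q D P) S = 0 ↔ SolvesMStep D P S) ∧
      (IsMaxOn (Q D P) {S' | 0 < S'.sigma2} S ↔ SolvesMStep D P S)) ∧
    -- `μ*` and `δ_ε*`: each update is affine in `W*`
    (∀ S : Param d k, ∃ L : (Fin d → Fin k → ℝ) →ᵃ[ℝ] Matrix (Fin 1) (Fin d) ℝ,
      ∀ W, muUpdate D P (W, S.2) = L W) ∧
    (∀ S : Param d k, ∃ L : (Fin d → Fin k → ℝ) →ᵃ[ℝ] Matrix (Fin 1) (Fin d) ℝ,
      ∀ W, deltaEpsUpdate D P (W, S.2) = L W) ∧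
    -- and so is the unique joint solution of the two equations
    (∃ L : (Fin d → Fin k → ℝ) →ᵃ[ℝ] Matrix (Fin 1) (Fin d) ℝ × Matrix (Fin 1) (Fin d) ℝ,
      ∀ S : Param d k, (S.mu = muUpdate D P S ∧ S.deltaEps = deltaEpsUpdate D P S) ↔
        (S.mu, S.deltaEps) = L S.1) ∧
    -- `σ*²`: affine in `W*` outside the integrals, and affine in `W*` inside the integrals
    (∀ (w : Matrix (Fin d) (Fin k) ℝ) (S : Param d k), ∃ L : (Fin d → Fin k → ℝ) →ᵃ[ℝ] ℝ,
      ∀ W, sigma2Formula D P w (W, S.2) = L W) ∧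
    (∀ S : Param d k, ∃ L : Matrix (Fin d) (Fin k) ℝ →ᵃ[ℝ] ℝ,
      ∀ w, sigma2Formula D P w S = L w) ∧
    -- `f` is affine in `(μ*, δ_ε*)`
    (∀ S : Param d k, ∃ L : (Fin d → ℝ) × (Fin d → ℝ) →ᵃ[ℝ] Matrix (Fin d) (Fin k) ℝ,
      ∀ mu' delta', f D P (S.1, mu', S.2.2.1, delta', S.2.2.2.2) = L (mu', delta')) := by

  -- Λ depends on Ψ and the data only, so one choice serves all Ψ*.
  obtain ⟨Λ, hΛ⟩ : ∃ Λ, Extends D P Λ := exists_linear_extension D P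
  refine ⟨fun S hS => hΛ.stationary hconv hnuEps hnuX hP hN hd hS,
    fun S => hΛ.isAffineFun_muUpdate hconv S, fun S => isAffineFun_deltaEpsUpdate S,
    hΛ.exists_joint_solution hconv hN hnuEps hnuX hP,
    fun w S => isAffineFun_sigma2Formula_outside w S,
    fun S => hΛ.isAffineFun_sigma2Formula_inside hconv S, fun S => ?_⟩
  obtain ⟨L, hL⟩ := hΛ.isAffineFun_f hconv S
  exact ⟨L, fun mu' delta' => hL (mu', delta')⟩
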